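/- Let $r,p,n$ be positive integers with $p\mid r$. Write $\mathbb Z_r=\mathbb Z/r\mathbb Z$, identified with $\{0,1,\dots,r-1\}$ where needed. Let $\mathbb Z_r\wr S_n$ be the group of pairs $g=(x,\pi)$ with $x\in(\mathbb Z_r)^n$, $\pi\in S_n$ and product $(x,\pi)(y,\sigma)=\big((x_{\sigma(i)}+y_i)_{i},\,\pi\sigma\big)$. For $g=(x,\pi)$ put $|g|=\pi$, $z_g(i)=x_i$, $\Delta(g)=x_1+\dots+x_n\in\mathbb Z_r$, and $g^T=\big((x_{\pi^{-1}(i)})_i,\,\pi^{-1}\big)$. Let $G(r,p,n)=\{g\in\mathbb Z_r\wr S_n:\Delta(g)\in p\mathbb Z_r\}$, and let $\mathcal V_{r,p,n}$ be the $\mathbb Q$-vector space with basis $\{C_\omega:\omega\in G(r,p,n),\ \omega^T=\omega\}$. Suppose that $\gcd(p,n)=1$ and that both $p$ and $r/p$ are even. For $g,\omega\in G(r,p,n)$ let $\epsilon_\omega=1$ if $\Delta(\omega)\in 2p\mathbb Z_r$ and $\epsilon_\omega=0$ otherwise. Let $\widetilde B(g,\omega)$ be the set of those $i\in\{1,\dots,n\}$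 with $|\omega|(i)=i$ for which there is an integer $k$ with $0\le k\le r/2-1$ and $2k+\epsilon_\omega=z_\omega(i)$ such that $z_g(i)+k$, reduced modulo $r$ to $\{0,\dots,r-1\}$, lies in $\{r/2,\dots,r-1\}$. For $\pi\in S_n$ let $\mathrm{Inv}(\pi)=\{(i,j):i<j,\ \pi(i)>\pi(j)\}$ and $\mathrm{Pair}(\pi)=\{(i,j):i<j,\ \pi(i)=j,\ \pi(j)=i\}$, and put $$\widetilde{\mathrm{sign}}_{r,p,n}(g,\omega)=(-1)^{|\widetilde B(g,\omega)|}\,(-1)^{|\mathrm{Inv}(|g|)\cap\mathrm{Pair}(|\omega|)|}.$$ Then $$\widetilde\rho_{r,p,n}(g)\,C_\omega=\widetilde{\mathrm{sign}}_{r,p,n}(g,\omega)\;C_{g\omega g^T}\qquad(g,\omega\in G(r,p,n),\ \omega^T=\omega)$$ defines a representation $\widetilde\rho_{r,p,n}$ of $G(r,p,n)$ on $\mathcal V_{r,p,n}$, and this representation is a Gelfand model for $G(r,p,n)$: after extension of scalars to $\mathbb C$ it is equivalent to the direct sum of all irreducible complex representations of $G(r,p,n)$, each equivalence class occurring exactly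 once. -/

import Mathlib

/-- The wreath product `ℤ_r ≀ S_n`: pairs `(x, π)` with `x ∈ (ℤ_r)ⁿ` and `π ∈ S_n`.
The index set `[1,n]` is `Fin n`. -/
@[ext]
structure WreathProd (r n : ℕ) where
  /-- the vector part, `z_g` -/
  z : Fin n → ZMod r
  /-- the permutation part, `|g|` -/
  perm : Equiv.Perm (Fin n)

namespace WreathProd

variable {r n : ℕ}

/-- `(x,π)(y,σ) = (σ⁻¹(x) + y, πσ)`, where `π(x)ᵢ = x_{π⁻¹(i)}`, so that `σ⁻¹(x)ᵢ = x_{σ(i)}`. -/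
instance : Mul (WreathProd r n) :=
  ⟨fun g h => ⟨fun i => g.z (h.perm i) + h.z i, g.perm * h.perm⟩⟩

instance : One (WreathProd r n) := ⟨⟨0, 1⟩⟩

/-- `(x,π)⁻¹ = (-π(x), π⁻¹)`. -/
instance : Inv (WreathProd r n) := ⟨fun g => ⟨fun i => -g.z (g.perm⁻¹ i), g.perm⁻¹⟩⟩

@[simp] theorem mul_z (g h : WreathProd r n) (i : Fin n) :
    (g * h).z i = g.z (h.perm i) + h.z i := rfl
@[simp] theorem mul_perm (g h : WreathProd r n) : (g * h).perm = g.perm * h.perm := rfl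
@[simp] theorem one_z (i : Fin n) : (1 : WreathProd r n).z i = 0 := rfl
@[simp] theorem one_perm : (1 : WreathProd r n).perm = 1 := rfl
@[simp] theorem inv_z (g : WreathProd r n) (i : Fin n) : (g⁻¹).z i = -g.z (g.perm⁻¹ i) := rfl
@[simp] theorem inv_perm (g : WreathProd r n) : (g⁻¹).perm = g.perm⁻¹ := rfl

instance : Group (WreathProd r n) :=
  Group.ofLeftAxioms
    (fun a b c => by ext <;> simp [add_assoc])
    (fun a => by ext <;> simp)
    (fun a => by ext <;> simp)

instance [NeZero r] : Finite (WreathProd r n) :=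
  Finite.of_injective (fun g : WreathProd r n => (g.z, g.perm)) fun a b h => by
    ext i
    · exact congrFun (congrArg Prod.fst h) i
    · exact congrArg (fun f : Equiv.Perm (Fin n) => ((f i : Fin n) : ℕ)) (congrArg Prod.snd h)

/-- `ḡ = (-x, π)` for `g = (x, π)`. -/
def bar (g : WreathProd r n) : WreathProd r n := ⟨fun i => -g.z i, g.perm⟩

/-- The transpose `gᵀ`, the bar of `g⁻¹`. -/
def transpose (g : WreathProd r n) : WreathProd r n := bar g⁻¹

/-- `gᵀ = (π(x), π⁻¹)` for `g = (x, π)`. -/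
theorem transpose_eq (g : WreathProd r n) :
    g.transpose = ⟨fun i => g.z (g.perm⁻¹ i), g.perm⁻¹⟩ := by
  ext <;> simp [transpose, bar]

theorem transpose_mul (g h : WreathProd r n) :
    (g * h).transpose = h.transpose * g.transpose := by
  ext <;> simp [transpose, bar, add_comm]

theorem transpose_transpose (g : WreathProd r n) : g.transpose.transpose = g := by
  ext <;> simp [transpose, bar]

theorem conj_transpose (g ω : WreathProd r n) (h : ω.transpose = ω) :
    (g * ω * g.transpose).transpose = g * ω * g.transpose := by
  rw [transpose_mul, transpose_mul, transpose_transpose, h, mul_assoc]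

/-- `Δ(x,π) = x₁ + ⋯ + xₙ`. -/
def delta (g : WreathProd r n) : ZMod r := ∑ i, g.z i

theorem delta_one : delta (1 : WreathProd r n) = 0 := by simp [delta]

theorem delta_mul (g h : WreathProd r n) : delta (g * h) = delta g + delta h := by
  simp only [delta, mul_z, Finset.sum_add_distrib]
  rw [Equiv.sum_comp h.perm g.z]

theorem delta_inv (g : WreathProd r n) : delta g⁻¹ = -delta g := by
  simp only [delta, inv_z, Finset.sum_neg_distrib]
  rw [Equiv.sum_comp g.perm⁻¹ g.z]

theorem delta_transpose (g : WreathProd r n) : delta g.transpose = delta g := by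
  rw [transpose_eq]
  exact Equiv.sum_comp g.perm⁻¹ g.z

/-- `Inv(π) = {(i,j) : i < j, π(i) > π(j)}`. -/
def invSet (π : Equiv.Perm (Fin n)) : Finset (Fin n × Fin n) :=
  Finset.univ.filter fun ij => ij.1 < ij.2 ∧ π ij.2 < π ij.1

/-- `Pair(π) = {(i,j) : i < j, π(i) = j, π(j) = i}`. -/
def pairSet (π : Equiv.Perm (Fin n)) : Finset (Fin n × Fin n) :=
  Finset.univ.filter fun ij => ij.1 < ij.2 ∧ π ij.1 = ij.2 ∧ π ij.2 = ij.1

open Classical in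
/-- The set `B̃(g,ω)`. Elements of `ℤ_r` are identified with integers in `[0, r-1]` by `ZMod.val`;
the sum `z_g(i) + k` is formed in `ℤ_r`. -/
noncomputable def modB (p : ℕ) (g ω : WreathProd r n) : Finset (Fin n) :=
  if delta ω ∈ AddSubgroup.zmultiples ((2 * p : ℕ) : ZMod r) then
    Finset.univ.filter fun i => ω.perm i = i ∧
      ∃ k : ℕ, k < r / 2 ∧ 2 * k + 1 = (ω.z i).val ∧ r / 2 ≤ (g.z i + (k : ZMod r)).val
  else
    Finset.univ.filter fun i => ω.perm i = i ∧
      ∃ k : ℕ, k < r / 2 ∧ 2 * k = (ω.z i).val ∧ r / 2 ≤ (g.z i + (k : ZMod r)).val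

/-- The modified sign `(-1)^{|B̃(g,ω)|} (-1)^{|Inv(|g|) ∩ Pair(|ω|)|}`. -/
noncomputable def modSign (p : ℕ) (g ω : WreathProd r n) : ℚ :=
  (-1) ^ (modB p g ω).card * (-1) ^ (invSet g.perm ∩ pairSet ω.perm).card

end WreathProd

open WreathProd in
/-- The complex reflection group `G(r,p,n)`: the elements `g` of `ℤ_r ≀ S_n`
with `Δ(g) ∈ pℤ_r`. -/
def ReflGroup (r p n : ℕ) : Subgroup (WreathProd r n) where
  carrier := {g | g.delta ∈ AddSubgroup.zmultiples (p : ZMod r)}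
  one_mem' := by
    simp only [Set.mem_ofPred_eq, delta_one]
    exact zero_mem _
  mul_mem' {a b} ha hb := by
    simp only [Set.mem_ofPred_eq, delta_mul] at *
    exact add_mem ha hb
  inv_mem' {a} ha := by
    simp only [Set.mem_ofPred_eq, delta_inv] at *
    exact neg_mem ha

/-- The symmetric elements `ω = ωᵀ` of `G(r,p,n)`. -/
abbrev SymElem (r p n : ℕ) : Type :=
  {ω : ReflGroup r p n // (ω : WreathProd r n).transpose = ω}

open WreathProd in
theorem ReflGroup.transpose_mem {r p n : ℕ} {g : WreathProd r n} (hg : g ∈ ReflGroup r p n) :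
    g.transpose ∈ ReflGroup r p n := by
  have h : g.delta ∈ AddSubgroup.zmultiples (p : ZMod r) := hg
  rw [← delta_transpose] at h
  exact h

open WreathProd in
/-- The twisted conjugation `ω ↦ g ω gᵀ` of `G(r,p,n)` on its symmetric elements. -/
def SymElem.conj {r p n : ℕ} (g : ReflGroup r p n) (ω : SymElem r p n) : SymElem r p n :=
  ⟨⟨g * ω.1 * (g : WreathProd r n).transpose,
      mul_mem (mul_mem g.2 ω.1.2) (ReflGroup.transpose_mem g.2)⟩,
    conj_transpose g.1 ω.1.1 ω.2⟩

/-- The rational vector space `V_{r,p,n}` with basis `C_ω = Finsupp.single ω 1`, where `ω` ranges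
over the symmetric elements of `G(r,p,n)`. -/
abbrev SymSpace (r p n : ℕ) : Type := SymElem r p n →₀ ℚ

/-- The complexification of a rational representation. -/
noncomputable def Representation.complexify {G V : Type*} [Group G] [AddCommGroup V] [Module ℚ V]
    (ρ : Representation ℚ G V) : Representation ℂ G (TensorProduct ℚ ℂ V) where
  toFun g := (ρ g).baseChange ℂ
  map_one' := by rw [map_one, LinearMap.baseChange_one]
  map_mul' g h := by rw [map_mul, LinearMap.baseChange_mul]

/-- A complex representation of a finite group `G` is a Gelfand model if it is equivalent to the
multiplicity-free sum of all irreducible complex representations of `G`, i.e. to `⨁ i, σ i` for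
a family `σ` of irreducible representations which contains each irreducible representation
exactly once up to equivalence. (As irreducible representations of a finite group are
finite-dimensional, it is enough to consider those on spaces in `Type`.) -/
def IsGelfandModel {G V : Type*} [Group G] [Finite G] [AddCommGroup V] [Module ℂ V]
    (ρ : Representation ℂ G V) : Prop :=
  ∃ (ι : Type) (W : ι → Type) (_ : ∀ i, AddCommGroup (W i)) (_ : ∀ i, Module ℂ (W i))
    (σ : ∀ i, Representation ℂ G (W i)),
    (∀ i, (σ i).IsIrreducible) ∧
    (∀ i j, Nonempty ((σ i).Equiv (σ j)) → i = j) ∧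
    (∀ (U : Type) [AddCommGroup U] [Module ℂ U] (τ : Representation ℂ G U),
      τ.IsIrreducible → ∃ i, Nonempty (τ.Equiv (σ i))) ∧
    Nonempty (ρ.Equiv (Representation.directSum σ))

/-!
Write `θ(g) = ḡ`, an involutive automorphism of `G = G(r,p,n)`. The representation `ρ̃` is a
Gelfand model because its character is `g ↦ #{h ∈ G : h * θ(h) = g}`, and because `θ(g)` is
conjugate to `g⁻¹` for every `g`.

These two facts suffice (`Representation.isGelfandModel_of_character`): the multiplicity of an
irreducible `τ` in `ρ̃` is then the twisted Frobenius–Schur indicator `|G|⁻¹ ∑ χ_τ(h * θ(h))`. As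
`τ ∘ θ` is the dual of `τ`, the invariants of `τ ⊗ (τ ∘ θ)` form a line, and the indicator is the
eigenvalue `±1` of the flip on this line. Being a multiplicity, it is `1`.

The conjugacy (`ReflGroup.isConj_barHom`) holds in the wreath product, where each cycle of the
permutation can be reflected; the conjugating element can be multiplied by a scalar to bring it
into `G`, since `p` and `n` are coprime.

For the character, fix `g = (x, π)`. The trace of `ρ̃(g)` is a signed sum over the symmetric `ω =
(y, σ)` with `g ω gᵀ = ω`, that is, over the involutions `σ` commuting with `π` and the solutions
`y` of `y ∘ σ = y`, `y ∘ π = y + x + x ∘ σ`.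

* For fixed `σ`, the sign coming from `modB` is determined by the sum of `x` over the contributing
  fixed points of `σ` (`WreathProd.half_mul_card_modB`). If the sum of `x` over some cycle of `π`
  fixed pointwise by `σ` is not zero, a suitable translation of `y` reverses the sign, and the sum
  over `y` vanishes (`WreathProd.fixSignSum_eq_zero`). Otherwise all signs are `1`, and the number
  of solutions in `G` is `1 / p` times the number of all solutions, which is a number
  `Equiv.Perm.weight` that only depends on the action of `σ` on the cycles of `π`
  (`WreathProd.mul_fixSignSum`).
* The sign coming from `Inv(π) ∩ Pair(σ)` changes when `σ` is switched, on a cycle of even length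
  which it preserves, between the identity and the rotation by half the length. So these `σ`
  cancel (`Equiv.Perm.sum_pairSign_mul_weight`); all others have sign `1`.
* The remaining `σ` correspond to the square roots `t` of `π`, with the same action on the cycles
  of `π` (`Equiv.Perm.sum_pairSign_mul_weight_eq_sum_sq`): two cycles exchanged by `σ` are merged
  into one cycle of `t`, and on a cycle of odd length `π` has a unique square root preserving the
  cycle.
* The solutions `h = (u, t)` of `h * θ(h) = g` are given by `t² = π`, `u ∘ t - u = x`, and for
  given `t` their number is again `1 / p` times the weight of `t` (`SymElem.mul_card_mul_bar_eq`).
-/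

/-! ### Multiplicity-free representations and twisted Frobenius–Schur indicators -/

section

open scoped MonoidAlgebra TensorProduct

namespace Representation

section Gelfand

variable {k G V : Type*} [Field k] [Group G] [AddCommGroup V] [Module k V]

/-- A module over the group algebra, viewed as a representation and then again as a module, is
the module one started from. -/
noncomputable def ofModule'AsModuleEquiv (M : Type*) [AddCommGroup M] [Module k M] [Module k[G] M]
    [IsScalarTower k k[G] M] : (ofModule' (k := k) (G := G) M).asModule ≃ₗ[k[G]] M where
  __ := (ofModule' (k := k) (G := G) M).asModuleEquiv.toAddEquiv
  map_smul' a x := by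
    refine ((ofModule' (k := k) (G := G) M).asModuleEquiv_map_smul a x).trans ?_
    have h : (ofModule' (k := k) (G := G) M).asAlgebraHom = Algebra.lsmul k k M :=
      (MonoidAlgebra.lift k (Module.End k M) G).apply_symm_apply _
    rw [h]
    rfl

/-- Maschke's theorem: a representation is a direct sum of irreducible representations. -/
theorem exists_equiv_directSum_irreducible {V : Type} [AddCommGroup V] [Module k V]
    [Finite G] [NeZero (Nat.card G : k)] (ρ : Representation k G V) :
    ∃ (ι : Type) (W : ι → Type) (_ : ∀ i, AddCommGroup (W i)) (_ : ∀ i, Module k (W i))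
      (σ : ∀ i, Representation k G (W i)),
      (∀ i, (σ i).IsIrreducible) ∧ Nonempty (ρ.Equiv (Representation.directSum σ)) := by
  obtain ⟨s, e, -, hs⟩ := IsSemisimpleModule.exists_linearEquiv_dfinsupp k[G] ρ.asModule
  refine ⟨s, fun m => m.1, fun m => inferInstance, fun m => inferInstance,
    fun m => ofModule' m.1, fun m => ?_,
    ⟨Equiv.mk (ρ.asModuleEquiv.symm.trans (e.restrictScalars k)) fun g => ?_⟩⟩
  · rw [irreducible_iff_isSimpleModule_asModule]
    have := hs m
    exact IsSimpleModule.congr (ofModule'AsModuleEquiv (k := k) (G := G) m.1)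
  · ext v : 1
    have h := e.map_smul (MonoidAlgebra.single g (1 : k)) (ρ.asModuleEquiv.symm v)
    rw [single_smul, one_smul] at h
    refine Eq.trans h ?_
    refine DFinsupp.ext fun i => ?_
    rfl

/-- Schur's lemma for a direct sum: if every irreducible representation occurs exactly once in
`ρ`, then `ρ` is a Gelfand model. -/
theorem isGelfandModel_of_finrank_intertwiningMap {V : Type} [AddCommGroup V] [Module ℂ V]
    [Finite G] (ρ : Representation ℂ G V)
    (h : ∀ (U : Type) [AddCommGroup U] [Module ℂ U] (τ : Representation ℂ G U),
      τ.IsIrreducible → Module.finrank ℂ (IntertwiningMap τ ρ) = 1) :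
    IsGelfandModel ρ := by
  classical
  obtain ⟨ι, W, _, _, σ, hσ, ⟨E⟩⟩ := exists_equiv_directSum_irreducible ρ
  -- the inclusion of a summand into `ρ`
  let incl (i : ι) : IntertwiningMap (σ i) ρ := E.symm.toIntertwiningMap.comp
    ⟨DirectSum.lof ℂ ι W i, fun g => by ext v; simp [directSum]⟩
  have incl_apply (i : ι) (v : W i) : incl i v = E.symm (DirectSum.lof ℂ ι W i v) := rfl
  let proj (i : ι) : IntertwiningMap ρ (σ i) := IntertwiningMap.comp
    ⟨DirectSum.component ℂ ι W i, fun g => LinearMap.ext fun x => rfl⟩ E.toIntertwiningMap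
  have proj_apply (i : ι) (v : V) : proj i v = E v i := rfl
  refine ⟨ι, W, _, _, σ, hσ, fun i j ⟨φ⟩ => ?_, fun U _ _ τ hτ => ?_, ⟨E⟩⟩
  · by_contra hij
    have := hσ i
    have : Nontrivial (W i) := by
      have := (irreducible_iff_isSimpleModule_asModule (σ i)).1 (hσ i)
      exact IsSimpleModule.nontrivial ℂ[G] (σ i).asModule
    obtain ⟨v, hv⟩ := exists_ne (0 : W i)
    have hne : incl i ≠ 0 := fun h0 => hv <| by
      have := congrArg (proj i) (DFunLike.congr_fun h0 v)
      simpa [incl_apply, proj_apply] using this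
    obtain ⟨a, ha⟩ := (finrank_eq_one_iff_of_nonzero' _ hne).1 (h _ (σ i) (hσ i))
      ((incl j).comp φ.toIntertwiningMap)
    have h1 := congrArg (proj j) (DFunLike.congr_fun ha v)
    have h2 : φ v = 0 := by
      have h3 : proj j ((a • incl i) v) = 0 := by
        rw [IntertwiningMap.smul_apply, map_smul, proj_apply, incl_apply, Equiv.apply_symm_apply,
          DirectSum.lof_eq_of, DirectSum.of_eq_of_ne _ _ _ (Ne.symm hij), smul_zero]
      have h4 : proj j (((incl j).comp φ.toIntertwiningMap) v) = φ v := by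
        refine (proj_apply j _).trans ?_
        rw [IntertwiningMap.comp_apply, incl_apply, Equiv.apply_symm_apply, DirectSum.lof_apply]
        rfl
      rw [← h4, ← h1, h3]
    exact hv (φ.toLinearEquiv.map_eq_zero_iff.1 h2)
  · have : Nontrivial (IntertwiningMap τ ρ) :=
      Module.nontrivial_of_finrank_pos (R := ℂ) (by rw [h U τ hτ]; exact one_pos)
    obtain ⟨f, hf⟩ := exists_ne (0 : IntertwiningMap τ ρ)
    obtain ⟨v, hv⟩ : ∃ v, f v ≠ 0 := by
      by_contra! H
      exact hf (DFunLike.ext _ _ H)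
    obtain ⟨i, hi⟩ : ∃ i, proj i (f v) ≠ 0 := by
      by_contra! H
      refine hv (E.toLinearEquiv.map_eq_zero_iff.1 (DFinsupp.ext H))
    have := hσ i
    rcases IsIrreducible.bijective_or_eq_zero ((proj i).comp f) with hb | h0
    · exact ⟨i, ⟨IntertwiningMap.ofBijective _ hb⟩⟩
    · exact absurd (DFunLike.congr_fun h0 v) hi

theorem IsIrreducible.finiteDimensional [Finite G] (ρ : Representation k G V)
    [ρ.IsIrreducible] :
    FiniteDimensional k V := by
  have : Module.Finite k[G] ρ.asModule := inferInstance
  have : Module.Finite k k[G] := inferInstance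
  have : Module.Finite k ρ.asModule := Module.Finite.trans k[G] _
  exact Module.Finite.equiv ρ.asModuleEquiv

/-- Composing `A ⊗ B` with the flip turns the product of traces into the trace of the product. -/
theorem trace_comm_comp_map [FiniteDimensional k V] (A B : V →ₗ[k] V) :
    LinearMap.trace k (V ⊗[k] V)
      ((_root_.TensorProduct.comm k V V).toLinearMap ∘ₗ TensorProduct.map A B) =
      LinearMap.trace k V (A * B) := by
  classical
  let b := Module.finBasis k V
  rw [LinearMap.trace_eq_matrix_trace k (b.tensorProduct b), LinearMap.trace_eq_matrix_trace k b,
    LinearMap.toMatrix_mul]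
  simp [Matrix.trace, LinearMap.toMatrix_apply, Fintype.sum_prod_type, Matrix.mul_apply]
  rw [Finset.sum_comm]

/-- The twisted Frobenius–Schur indicator of an irreducible representation `τ` with respect to an
involutive automorphism `θ` for which `τ ∘ θ` is the dual of `τ` is `1` or `-1`: it is the
eigenvalue of the flip on the line of invariants of `τ ⊗ (τ ∘ θ)`. -/
theorem sq_twisted_indicator {U : Type*} [Fintype G] [AddCommGroup U] [Module ℂ U]
    (τ : Representation ℂ G U) [τ.IsIrreducible] (θ : G →* G)
    (hθ : ∀ g, θ (θ g) = g) (hc : ∀ g, IsConj (θ g) g⁻¹) :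
    ((Nat.card G : ℂ)⁻¹ * ∑ g, τ.character (g * θ g)) ^ 2 = 1 := by
  have := IsIrreducible.finiteDimensional τ
  have hG : (Nat.card G : ℂ) ≠ 0 := by simp
  have hG' : (Fintype.card G : ℂ) ≠ 0 := by simp
  let _ := invertibleOfNonzero hG
  let _ := invertibleOfNonzero hG'
  let τ' : Representation ℂ G U := τ.comp θ
  let T := τ.tprod τ'
  have hχ (g : G) : τ'.character g = τ.character g⁻¹ := by
    obtain ⟨c, hc⟩ := isConj_iff.1 (hc g)
    rw [← hc, char_conj]
    rfl
  have hfin : Module.finrank ℂ T.invariants = 1 := by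
    have h1 := card_inv_mul_sum_char_eq_finrank T
    have h2 := char_orthonormal τ τ
    rw [if_pos ⟨.refl τ⟩] at h2
    rw [char_tensor] at h1
    simp only [Pi.mul_apply, hχ] at h1
    rw [h2] at h1
    exact_mod_cast h1.symm
  let F : U ⊗[ℂ] U →ₗ[ℂ] U ⊗[ℂ] U := (_root_.TensorProduct.comm ℂ U U).toLinearMap
  have hFF (x) : F (F x) = x := by
    simp [F]
  have hFT (g : G) (x) : T g (F x) = F (T (θ g) x) := by
    induction x with
    | zero => simp
    | add x y hx hy => simp [hx, hy]
    | tmul x y => simp [F, T, τ', hθ]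
  obtain ⟨v, hv0, hv⟩ := finrank_eq_one_iff'.1 hfin
  have hFv : F v ∈ T.invariants := fun g => by rw [hFT, v.2 (θ g)]
  obtain ⟨c, hcv⟩ := hv ⟨F v, hFv⟩
  have hcv' : c • (v : U ⊗[ℂ] U) = F v := congrArg Subtype.val hcv
  have hv0' : (v : U ⊗[ℂ] U) ≠ 0 := fun h => hv0 (Subtype.ext h)
  have hc2 : c ^ 2 = 1 := by
    have h3 : (c ^ 2) • (v : U ⊗[ℂ] U) = (1 : ℂ) • (v : U ⊗[ℂ] U) := by
      rw [pow_two, mul_smul, hcv', ← map_smul, hcv', hFF, one_smul]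
    exact smul_left_injective ℂ hv0' h3
  have hFP : F ∘ₗ T.averageMap = c • T.averageMap := by
    refine LinearMap.ext fun y => ?_
    obtain ⟨a, ha⟩ := hv ⟨_, averageMap_invariant T y⟩
    have ha' : a • (v : U ⊗[ℂ] U) = T.averageMap y := congrArg Subtype.val ha
    rw [LinearMap.comp_apply, LinearMap.smul_apply, ← ha', map_smul, ← hcv', smul_comm]
  have htr : LinearMap.trace ℂ _ (F ∘ₗ T.averageMap) =
      (Nat.card G : ℂ)⁻¹ * ∑ g, τ.character (g * θ g) := by
    have : F ∘ₗ T.averageMap = (Nat.card G : ℂ)⁻¹ • ∑ g, F ∘ₗ T g := by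
      refine LinearMap.ext fun y => ?_
      simp [averageMap, GroupAlgebra.average]
    rw [this, map_smul, map_sum, smul_eq_mul]
    congr 1
    refine Finset.sum_congr rfl fun g _ => ?_
    rw [character, map_mul]
    exact trace_comm_comp_map _ _
  have htrP : LinearMap.trace ℂ _ T.averageMap = 1 := by
    rw [(isProj_averageMap T).trace, hfin, Nat.cast_one]
  rw [← htr, hFP, map_smul, htrP, smul_eq_mul, mul_one, hc2]

/-- If the character of `ρ` counts the solutions of `h * θ h = g` for an involutive automorphism
`θ` which maps each `g` to a conjugate of `g⁻¹`, then the multiplicities of the irreducible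
representations in `ρ` are their twisted indicators. These are `±1`, hence `1`. -/
theorem isGelfandModel_of_character {V : Type} [AddCommGroup V] [Module ℂ V]
    [FiniteDimensional ℂ V] [Finite G] (ρ : Representation ℂ G V) (θ : G →* G)
    (hθ : ∀ g, θ (θ g) = g) (hc : ∀ g, IsConj (θ g) g⁻¹)
    (hρ : ∀ g, ρ.character g = Nat.card {h : G // h * θ h = g}) : IsGelfandModel ρ := by
  classical
  have : Fintype G := Fintype.ofFinite G
  refine isGelfandModel_of_finrank_intertwiningMap ρ fun U _ _ τ hτ => ?_
  have := IsIrreducible.finiteDimensional τ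
  have hG : (Nat.card G : ℂ) ≠ 0 := by simp
  let _ := invertibleOfNonzero hG
  have h1 := card_inv_mul_sum_char_mul_char_eq_finrank τ ρ
  have h2 : ∑ g, ρ.character g * τ.character g⁻¹ = ∑ g, τ.character (g * θ g) := by
    calc ∑ g, ρ.character g * τ.character g⁻¹
        = ∑ g, ∑ h with h * θ h = g, τ.character (h * θ h)⁻¹ := by
          refine Finset.sum_congr rfl fun g _ => ?_
          rw [hρ, Finset.sum_congr rfl (g := fun _ => τ.character g⁻¹)
            fun h hh => by rw [(Finset.mem_filter.1 hh).2], Finset.sum_const, nsmul_eq_mul,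
            Nat.card_eq_fintype_card, Fintype.card_subtype]
      _ = ∑ h, τ.character (h * θ h)⁻¹ :=
          Finset.sum_fiberwise_of_maps_to (fun _ _ => Finset.mem_univ _) _
      _ = ∑ h, τ.character (h * θ h) :=
          Fintype.sum_equiv (Equiv.inv G) _ _ fun h => by
            rw [mul_inv_rev, char_mul_comm, Equiv.inv_apply, map_inv]
  have h3 := sq_twisted_indicator τ θ hθ hc
  rw [← h2, h1] at h3
  exact Nat.eq_one_of_mul_eq_one_left (by rw [← pow_two]; exact_mod_cast h3)

end Gelfand

end Representation

end

/-! ### Cycle sums of a permutation -/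

namespace Equiv.Perm

section Cycles

variable {α : Type*} (π : Perm α)

/-- A chosen representative of the cycle of `π` through `i`. -/
noncomputable def cycleRep (i : α) : α := (Quotient.mk (SameCycle.setoid π) i).out

theorem sameCycle_cycleRep (i : α) : π.SameCycle (π.cycleRep i) i :=
  Quotient.exact (s := SameCycle.setoid π) (Quotient.out_eq _)

theorem cycleRep_eq_iff {i j : α} : π.cycleRep i = π.cycleRep j ↔ π.SameCycle i j :=
  ⟨fun h => (π.sameCycle_cycleRep i).symm.trans (h ▸ π.sameCycle_cycleRep j),
    fun h => congrArg Quotient.out (Quotient.sound (s := SameCycle.setoid π) h)⟩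

/-- Every permutation is conjugate to its inverse by an element which preserves all cycles: the
reflection of each cycle at a representative. -/
theorem exists_reverse : ∃ τ : Perm α, τ * π = π⁻¹ * τ ∧ ∀ i, π.SameCycle i (τ i) := by
  choose k hk using π.sameCycle_cycleRep
  have key (b : α) (s t : ℤ) (h : (π ^ s) b = (π ^ t) b) : (π ^ (-s)) b = (π ^ (-t)) b := by
    have := congrArg (π ^ (-s - t)) h
    rw [← mul_apply, ← mul_apply, ← zpow_add, ← zpow_add] at this
    rw [show -s = -s - t + t by ring, ← this]
    congr 2
    ring
  let f (i : α) : α := (π ^ (-k i)) (π.cycleRep i)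
  have hf (b : α) (hb : π.cycleRep b = b) (s : ℤ) : f ((π ^ s) b) = (π ^ (-s)) b := by
    have h1 : π.cycleRep ((π ^ s) b) = b := by
      conv_rhs => rw [← hb]
      exact π.cycleRep_eq_iff.2 (SameCycle.symm ⟨s, rfl⟩)
    have h2 := hk ((π ^ s) b)
    simp only [f]
    rw [h1] at h2 ⊢
    exact key b _ _ h2
  have hrep (i : α) : π.cycleRep (π.cycleRep i) = π.cycleRep i :=
    π.cycleRep_eq_iff.2 (π.sameCycle_cycleRep i)
  have hff : Function.Involutive f := fun i => by
    have : f i = (π ^ (-k i)) (π.cycleRep i) := rfl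
    rw [this, hf _ (hrep i), neg_neg, hk]
  refine ⟨hff.toPerm, Equiv.ext fun i => ?_, fun i => ?_⟩
  · change f (π i) = π⁻¹ (f i)
    have h1 : π i = (π ^ (k i + 1)) (π.cycleRep i) := by
      rw [add_comm, zpow_add, mul_apply, hk, zpow_one]
    rw [h1, hf _ (hrep i), neg_add_rev, zpow_add, mul_apply, zpow_neg_one]
  · change π.SameCycle i (f i)
    exact (π.sameCycle_cycleRep i).symm.trans ⟨_, rfl⟩

end Cycles

section CycleSum

variable {α A : Type*} [Fintype α] [AddCommGroup A] (π : Perm α)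

open Classical in
/-- The sum of `w` over the cycle of `π` through `i`. -/
noncomputable def cycleSum (w : α → A) (i : α) : A := ∑ j with π.SameCycle i j, w j

variable {π}

theorem cycleSum_congr {i j : α} (h : π.SameCycle i j) (w : α → A) :
    π.cycleSum w i = π.cycleSum w j := by
  classical
  exact Finset.sum_congr (Finset.filter_congr fun l _ =>
    ⟨fun h' => h.symm.trans h', fun h' => h.trans h'⟩) fun _ _ => rfl

theorem cycleSum_add (v w : α → A) (i : α) :
    π.cycleSum (fun j => v j + w j) i = π.cycleSum v i + π.cycleSum w i :=
  Finset.sum_add_distrib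

theorem cycleSum_ext {v w : α → A} {i : α} (h : ∀ j, π.SameCycle i j → v j = w j) :
    π.cycleSum v i = π.cycleSum w i := by
  classical
  exact Finset.sum_congr rfl fun j hj => h j (Finset.mem_filter.1 hj).2

/-- Reindexing a cycle sum along a map which carries cycles of `π` to cycles of `π'`. -/
theorem cycleSum_comp {π' : Perm α} (σ : Perm α) (w : α → A) (i : α)
    (h : ∀ j, π.SameCycle i j ↔ π'.SameCycle (σ i) (σ j)) :
    π.cycleSum (fun j => w (σ j)) i = π'.cycleSum w (σ i) := by
  classical
  refine Finset.sum_equiv σ (fun j => ?_) fun _ _ => rfl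
  simp [h]

theorem cycleSum_comp_self (w : α → A) (i : α) :
    π.cycleSum (fun j => w (π j)) i = π.cycleSum w i := by
  rw [cycleSum_comp (π' := π) π w i (by simp), ← cycleSum_congr (i := i) ⟨1, by simp⟩]

/-- A function is a coboundary for the action of `π` exactly if its sums over the cycles of `π`
vanish. -/
theorem exists_sub_eq_iff (w : α → A) :
    (∃ v : α → A, ∀ i, v (π i) - v i = w i) ↔ ∀ i, π.cycleSum w i = 0 := by
  classical
  constructor
  · rintro ⟨v, hv⟩ i
    have h := cycleSum_comp_self (π := π) v i
    have : π.cycleSum (fun j => v (π j)) i = π.cycleSum (fun j => v j + w j) i :=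
      cycleSum_ext fun j _ => by rw [← hv j]; abel
    rw [this, cycleSum_add] at h
    simpa using h
  · intro h
    have hex (i : α) : ∃ k : ℕ, (π ^ k) (π.cycleRep i) = i := by
      obtain ⟨k, -, hk⟩ := (π.sameCycle_cycleRep i).exists_pow_eq'
      exact ⟨k, hk⟩
    let k (i : α) : ℕ := Nat.find (hex i)
    have hk (i : α) : (π ^ k i) (π.cycleRep i) = i := Nat.find_spec (hex i)
    have hmin (i : α) (m : ℕ) (hm : (π ^ m) (π.cycleRep i) = i) : k i ≤ m :=
      Nat.find_min' (hex i) hm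
    have hrep (i : α) : π.cycleRep (π i) = π.cycleRep i :=
      π.cycleRep_eq_iff.2 (SameCycle.symm ⟨1, by simp⟩)
    -- `v i` is the sum of `w` along the path from the representative of the cycle to `i`
    refine ⟨fun i => ∑ t ∈ Finset.range (k i), w ((π ^ t) (π.cycleRep i)), fun i => ?_⟩
    have hsucc : (∑ t ∈ Finset.range (k i), w ((π ^ t) (π.cycleRep i))) + w i =
        ∑ t ∈ Finset.range (k i + 1), w ((π ^ t) (π.cycleRep i)) := by
      rw [Finset.sum_range_succ, hk]
    rw [sub_eq_iff_eq_add, add_comm (w i), hsucc]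
    have hki : (π ^ (k i + 1)) (π.cycleRep i) = π i := by rw [pow_succ', mul_apply, hk]
    by_cases hi : π i = π.cycleRep i
    · have h0 : k (π i) = 0 := Nat.le_zero.1 (hmin (π i) 0 (by rw [hrep, hi]; rfl))
      simp only [h0, Finset.range_zero, Finset.sum_empty]
      rw [← h (π.cycleRep i), cycleSum]
      refine (Finset.sum_bij (fun t _ => (π ^ t) (π.cycleRep i)) (fun t _ => ?_) ?_ ?_
        fun _ _ => rfl).symm
      · simp [SameCycle.refl]
      · have aux (s t : ℕ) (hst : s < t) (ht : t < k i + 1)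
            (he : (π ^ s) (π.cycleRep i) = (π ^ t) (π.cycleRep i)) : False := by
          have := hmin i (k i - t + s) (by
            rw [pow_add, mul_apply, he, ← mul_apply, ← pow_add, Nat.sub_add_cancel (by omega), hk])
          omega
        intro s hs t ht he
        rw [Finset.mem_range] at hs ht
        rcases lt_trichotomy s t with hst | hst | hst
        · exact (aux s t hst ht he).elim
        · exact hst
        · exact (aux t s hst hs he.symm).elim
      · intro j hj
        obtain ⟨m, -, hm⟩ := ((Finset.mem_filter.1 hj).2).exists_pow_eq'
        refine ⟨m % (k i + 1), Finset.mem_range.2 (Nat.mod_lt _ (Nat.succ_pos _)), ?_⟩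
        have hper : ((π ^ (k i + 1)) ^ (m / (k i + 1))) (π.cycleRep i) = π.cycleRep i :=
          Function.IsFixedPt.perm_pow (e := π ^ (k i + 1)) (hki.trans hi) _
        conv_rhs => rw [← hm, ← Nat.mod_add_div m (k i + 1), pow_add, pow_mul, mul_apply, hper]
    · have h1 : k (π i) = k i + 1 := by
        refine le_antisymm (hmin _ _ (by rw [hrep, hki])) ?_
        by_contra hlt
        have h2 := hk (π i)
        rw [hrep] at h2
        rcases hm : k (π i) with _ | m
        · rw [hm] at h2
          exact hi h2.symm
        · rw [hm, pow_succ', mul_apply] at h2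
          have := hmin i m (π.injective h2)
          omega
      simp only [h1, hrep]

end CycleSum

end Equiv.Perm

/-! ### Transposes and inverses in the groups `G(r,p,n)` -/

theorem ZMod.mem_zmultiples_natCast_iff {r d : ℕ} [NeZero r] (h : d ∣ r) (x : ZMod r) :
    x ∈ AddSubgroup.zmultiples (d : ZMod r) ↔ ZMod.castHom h (ZMod d) x = 0 := by
  constructor
  · rintro ⟨k, rfl⟩
    change ZMod.castHom h (ZMod d) (k • (d : ZMod r)) = 0
    rw [map_zsmul, map_natCast, ZMod.natCast_self, smul_zero]
  · intro hx
    rw [← ZMod.natCast_zmod_val x, map_natCast, ZMod.natCast_eq_zero_iff] at hx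
    obtain ⟨m, hm⟩ := hx
    refine ⟨m, ?_⟩
    rw [← ZMod.natCast_zmod_val x, hm]
    simp [mul_comm]

namespace WreathProd

variable {r n : ℕ}

theorem bar_mul (g h : WreathProd r n) : bar (g * h) = bar g * bar h := by
  ext <;> simp [bar, add_comm]

theorem bar_one : bar (1 : WreathProd r n) = 1 := by
  ext <;> simp [bar]

theorem bar_bar (g : WreathProd r n) : bar (bar g) = g := by
  ext <;> simp [bar]

theorem delta_bar (g : WreathProd r n) : delta (bar g) = -delta g := by
  simp [delta, bar]

/-- In the wreath product, `g` and `gᵀ` are conjugate by an element which can be altered by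
adding a constant to its vector part. -/
theorem exists_mul_eq_transpose_mul (g : WreathProd r n) :
    ∃ (a : Fin n → ZMod r) (τ : Equiv.Perm (Fin n)), ∀ c : ZMod r,
      (⟨fun i => a i + c, τ⟩ : WreathProd r n) * g =
        g.transpose * (⟨fun i => a i + c, τ⟩ : WreathProd r n) := by
  obtain ⟨τ, hτ, hs⟩ := g.perm.exists_reverse
  obtain ⟨a, ha⟩ := (Equiv.Perm.exists_sub_eq_iff (π := g.perm)
    (fun i => g.z ((g.perm⁻¹ * τ) i) + -g.z i)).2 fun i => by
      have hs' (j) : g.perm.SameCycle j ((g.perm⁻¹ * τ) j) := by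
        simpa using hs j
      have hneg := Equiv.Perm.cycleSum_add (π := g.perm) g.z (fun j => -g.z j) i
      rw [Equiv.Perm.cycleSum_add,
        Equiv.Perm.cycleSum_comp (π' := g.perm) _ _ _ fun j =>
          ⟨fun h => (hs' i).symm.trans (h.trans (hs' j)),
            fun h => (hs' i).trans (h.trans (hs' j).symm)⟩,
        ← Equiv.Perm.cycleSum_congr (hs' i), ← hneg]
      simp [Equiv.Perm.cycleSum]
  refine ⟨a, τ, fun c => ?_⟩
  rw [transpose_eq]
  ext i
  · simp only [mul_z]
    have := ha i
    rw [sub_eq_iff_eq_add] at this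
    rw [this, Equiv.Perm.mul_apply]
    abel
  · exact congrArg (fun σ : Equiv.Perm (Fin n) => ((σ i : Fin n) : ℕ)) hτ

end WreathProd

namespace ReflGroup

open WreathProd

variable {r p n : ℕ}

theorem mem_iff {g : WreathProd r n} :
    g ∈ ReflGroup r p n ↔ g.delta ∈ AddSubgroup.zmultiples (p : ZMod r) := Iff.rfl

/-- The automorphism `g ↦ ḡ` of `G(r,p,n)`. -/
def barHom (r p n : ℕ) : ReflGroup r p n →* ReflGroup r p n where
  toFun g := ⟨bar g, by
    rw [mem_iff, delta_bar]
    exact neg_mem (mem_iff.1 g.2)⟩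
  map_one' := Subtype.ext bar_one
  map_mul' g h := Subtype.ext (bar_mul _ _)

theorem barHom_barHom (g : ReflGroup r p n) : barHom r p n (barHom r p n g) = g :=
  Subtype.ext (bar_bar _)

/-- As `p` and `n` are coprime, adding a constant to the coordinates of a vector changes the sum
of the coordinates modulo `p` arbitrarily. -/
theorem exists_add_mul_mem_zmultiples (hgcd : Nat.gcd p n = 1) (s : ZMod r) :
    ∃ c : ZMod r, s + n * c ∈ AddSubgroup.zmultiples (p : ZMod r) := by
  have h := Nat.gcd_eq_gcd_ab p n
  rw [hgcd] at h
  have h' := congrArg (Int.cast : ℤ → ZMod r) h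
  push_cast at h'
  refine ⟨-(Nat.gcdB p n * s), (Nat.gcdA p n : ℤ) * (s.cast : ℤ), ?_⟩
  simp only [zsmul_eq_mul, Int.cast_mul, ZMod.intCast_zmod_cast]
  linear_combination (-s) * h'

/-- The bar automorphism maps each element to a conjugate of its inverse. -/
theorem isConj_barHom (hgcd : Nat.gcd p n = 1) (g : ReflGroup r p n) :
    IsConj (barHom r p n g) g⁻¹ := by
  obtain ⟨a, τ, h⟩ := exists_mul_eq_transpose_mul (g⁻¹ : WreathProd r n)
  obtain ⟨c, hc⟩ := exists_add_mul_mem_zmultiples (r := r) hgcd (∑ i, a i)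
  refine IsConj.symm (isConj_iff.2 ⟨⟨⟨fun i => a i + c, τ⟩, ?_⟩, ?_⟩)
  · rw [mem_iff]
    simpa [delta, Finset.sum_add_distrib] using hc
  · rw [mul_inv_eq_iff_eq_mul]
    refine Subtype.ext ((h c).trans ?_)
    rw [transpose, inv_inv]
    rfl

end ReflGroup

/-! ### The sign as a cocycle and the signed permutation representation -/

namespace WreathProd

variable {r n : ℕ}

section PairSign

open Equiv

theorem neg_one_pow_card_filter {α : Type*} [Fintype α] (P : α → Prop) [DecidablePred P] :
    (-1 : ℚ) ^ (Finset.univ.filter P).card = ∏ i, if P i then -1 else 1 := by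
  simp [Finset.prod_ite, Finset.prod_const]

/-- A product of a `σ`-invariant function over the pairs `{i, σ i}` can be computed with any choice
of representatives of the pairs. -/
theorem prod_transversal {α M : Type*} [Fintype α] [DecidableEq α] [CommMonoid M] {σ : Perm α}
    (hσ : ∀ i, σ (σ i) = i) (f : α → M) (hf : ∀ i, f (σ i) = f i) (P Q : α → Prop)
    [DecidablePred P] [DecidablePred Q] (hP : ∀ i, σ i ≠ i → (P (σ i) ↔ ¬P i))
    (hQ : ∀ i, σ i ≠ i → (Q (σ i) ↔ ¬Q i)) :
    ∏ i with σ i ≠ i ∧ P i, f i = ∏ i with σ i ≠ i ∧ Q i, f i := by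
  have hne (i) : σ (σ i) ≠ σ i ↔ σ i ≠ i := by rw [hσ, ne_comm]
  refine Finset.prod_bij' (fun i _ => if Q i then i else σ i) (fun i _ => if P i then i else σ i)
    ?_ ?_ ?_ ?_ ?_
  all_goals
    intro i hi
    obtain ⟨h1, h2⟩ := (Finset.mem_filter.1 hi).2
  · split_ifs with h <;> simp [*]
    exact fun h => h1 h.symm
  · split_ifs with h <;> simp [*]
    exact fun h => h1 h.symm
  · by_cases h : Q i <;> simp [*]
  · by_cases h : P i <;> simp [*]
  · split_ifs <;> simp [*]

/-- `invSign π i j` is `-1` if `π` inverts the order of `i` and `j`, and `1` otherwise. -/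
def invSign (π : Perm (Fin n)) (i j : Fin n) : ℚ := if π i < π j ↔ i < j then 1 else -1

theorem invSign_comm (π : Perm (Fin n)) (i j : Fin n) : invSign π i j = invSign π j i := by
  rcases eq_or_ne i j with rfl | h
  · rfl
  have h' : π i ≠ π j := fun e => h (π.injective e)
  have h1 : π j < π i ↔ ¬π i < π j :=
    ⟨fun a b => lt_asymm a b, fun a => lt_of_le_of_ne (not_lt.1 a) h'.symm⟩
  have h2 : j < i ↔ ¬i < j :=
    ⟨fun a b => lt_asymm a b, fun a => lt_of_le_of_ne (not_lt.1 a) h.symm⟩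
  simp only [invSign, h1, h2, not_iff_not]

theorem invSign_mul (g h : Perm (Fin n)) (i j : Fin n) :
    invSign (g * h) i j = invSign g (h i) (h j) * invSign h i j := by
  simp only [invSign, Perm.mul_apply]
  by_cases h1 : g (h i) < g (h j) <;> by_cases h2 : h i < h j <;> by_cases h3 : i < j <;>
    simp [h1, h2, h3]

/-- The sign `(-1) ^ |Inv(π) ∩ Pair(σ)|`. -/
def pairSign (π σ : Perm (Fin n)) : ℚ := (-1) ^ (invSet π ∩ pairSet σ).card

theorem pairSign_eq_prod {σ : Perm (Fin n)} (hσ : ∀ i, σ (σ i) = i) (π : Perm (Fin n))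
    (P : Fin n → Prop) [DecidablePred P] (hP : ∀ i, σ i ≠ i → (P (σ i) ↔ ¬P i)) :
    pairSign π σ = ∏ i with σ i ≠ i ∧ P i, invSign π i (σ i) := by
  rw [prod_transversal hσ _ (fun i => by rw [hσ, invSign_comm]) P (fun i => i < σ i) hP
    (fun i hi => by rw [hσ, not_lt, le_iff_lt_or_eq]; simp [hi])]
  have h1 : invSet π ∩ pairSet σ =
      (Finset.univ.filter fun i => i < σ i ∧ π (σ i) < π i).image fun i => (i, σ i) := by
    ext ⟨i, j⟩
    simp only [invSet, pairSet, Finset.mem_inter, Finset.mem_filter, Finset.mem_univ, true_and,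
      Finset.mem_image, Prod.mk.injEq]
    constructor
    · rintro ⟨⟨h1, h2⟩, -, rfl, -⟩
      exact ⟨i, ⟨h1, h2⟩, rfl, rfl⟩
    · rintro ⟨i, ⟨h1, h2⟩, rfl, rfl⟩
      exact ⟨⟨h1, h2⟩, h1, rfl, hσ i⟩
  rw [pairSign, h1, Finset.card_image_of_injective _ fun i j h => congrArg Prod.fst h,
    neg_one_pow_card_filter, Finset.prod_filter]
  refine Finset.prod_congr rfl fun i _ => ?_
  by_cases hi : i < σ i
  · have : π i ≠ π (σ i) := fun e => hi.ne (π.injective e)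
    simp only [hi, hi.ne', ne_eq, not_false_eq_true, and_self, invSign, true_and, if_true, iff_true]
    rcases lt_or_gt_of_ne this with h | h <;> simp [h, h.not_gt]
  · simp [hi]

/-- The sign of `Inv(π) ∩ Pair(σ)` is a cocycle for the conjugation action on involutions. -/
theorem pairSign_mul (g h : Perm (Fin n)) {σ : Perm (Fin n)} (hσ : ∀ i, σ (σ i) = i) :
    pairSign (g * h) σ = pairSign g (h * σ * h⁻¹) * pairSign h σ := by
  have hP (i) (hi : σ i ≠ i) : h (σ i) < h (σ (σ i)) ↔ ¬h i < h (σ i) := by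
    rw [hσ, not_lt, le_iff_lt_or_eq]; simp [hi]
  rw [pairSign_eq_prod hσ (g * h) (fun i => h i < h (σ i)) hP,
    pairSign_eq_prod hσ h (fun i => h i < h (σ i)) hP,
    pairSign_eq_prod (σ := h * σ * h⁻¹) (by simp [hσ]) g (fun i => i < (h * σ * h⁻¹) i)
      fun i hi => by
      have : (h * σ * h⁻¹) ((h * σ * h⁻¹) i) = i := by simp [hσ]
      rw [this, not_lt, le_iff_lt_or_eq]
      simp only [hi, or_false]]
  simp only [invSign_mul, Finset.prod_mul_distrib]
  congr 1
  refine Finset.prod_equiv h (fun i => ?_) fun i _ => by simp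
  rw [Finset.mem_filter, Finset.mem_filter]
  simp

theorem pairSign_one {σ : Perm (Fin n)} (hσ : ∀ i, σ (σ i) = i) : pairSign 1 σ = 1 := by
  have h := pairSign_mul 1 1 hσ
  simp only [mul_one, one_mul, inv_one] at h
  have h0 : pairSign 1 σ ≠ 0 := pow_ne_zero _ (by norm_num)
  exact (mul_left_cancel₀ h0 (by rw [mul_one]; exact h)).symm

end PairSign

section Conj

theorem conj_perm (h ω : WreathProd r n) :
    (h * ω * h.transpose).perm = h.perm * ω.perm * h.perm⁻¹ := by
  simp [transpose_eq]

theorem conj_z (h ω : WreathProd r n) (i : Fin n) :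
    (h * ω * h.transpose).z (h.perm i) = ω.z i + h.z i + h.z (ω.perm i) := by
  simp [transpose_eq]
  abel

theorem delta_conj (h ω : WreathProd r n) :
    delta (h * ω * h.transpose) = delta ω + 2 * delta h := by
  rw [delta_mul, delta_mul, delta_transpose]
  ring

theorem modSign_eq (p : ℕ) (g ω : WreathProd r n) :
    modSign p g ω = (-1) ^ (modB p g ω).card * pairSign g.perm ω.perm := rfl

theorem perm_perm_of_transpose_eq {ω : WreathProd r n} (h : ω.transpose = ω) (i : Fin n) :
    ω.perm (ω.perm i) = i := by
  rw [transpose_eq] at h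
  have h1 : ω.perm⁻¹ = ω.perm := congrArg perm h
  rw [← Equiv.Perm.mul_apply, mul_eq_one_iff_inv_eq.2 h1, Equiv.Perm.one_apply]

end Conj

section FixSign

/-- Reduction modulo `2` of the residues modulo an even number. -/
abbrev parity (h2 : 2 ∣ r) : ZMod r →+* ZMod 2 := ZMod.castHom h2 (ZMod 2)

/-- The integer part of one half of the representative of `y` in `{0, …, r-1}`. -/
def half (y : ZMod r) : ZMod r := ((y.val / 2 : ℕ) : ZMod r)

/-- The parity which the coordinate of `ω` at a fixed point has to have in order to contribute to
the set `modB p g ω`. -/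
noncomputable def fixParity (p : ℕ) (ω : WreathProd r n) : ZMod 2 :=
  open Classical in if delta ω ∈ AddSubgroup.zmultiples ((2 * p : ℕ) : ZMod r) then 1 else 0

variable [NeZero r]

theorem parity_apply (h2 : 2 ∣ r) (y : ZMod r) : parity h2 y = (y.val : ZMod 2) := by
  conv_lhs => rw [← ZMod.natCast_zmod_val y, map_natCast]

theorem mem_modB (h2 : 2 ∣ r) {p : ℕ} {g ω : WreathProd r n} {i : Fin n} :
    i ∈ modB p g ω ↔ (ω.perm i = i ∧ parity h2 (ω.z i) = fixParity p ω) ∧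
      r / 2 ≤ (g.z i + half (ω.z i)).val := by
  have hv := ZMod.val_lt (ω.z i)
  rw [parity_apply]
  unfold modB fixParity half
  split_ifs
  · rw [← Nat.cast_one (R := ZMod 2), ZMod.natCast_eq_natCast_iff']
    simp only [Finset.mem_filter, Finset.mem_univ, true_and, and_assoc]
    refine and_congr_right fun _ => ⟨?_, fun ⟨h1, h2⟩ => ⟨_, ?_, ?_, h2⟩⟩
    · rintro ⟨k, hk, h1, h3⟩
      have : (ω.z i).val / 2 = k := by omega
      exact ⟨by omega, by rwa [this]⟩
    · omega
    · omega
  · rw [← Nat.cast_zero (R := ZMod 2), ZMod.natCast_eq_natCast_iff']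
    simp only [Finset.mem_filter, Finset.mem_univ, true_and, and_assoc]
    refine and_congr_right fun _ => ⟨?_, fun ⟨h1, h2⟩ => ⟨_, ?_, ?_, h2⟩⟩
    · rintro ⟨k, hk, h1, h3⟩
      have : (ω.z i).val / 2 = k := by omega
      exact ⟨by omega, by rwa [this]⟩
    · omega
    · omega

omit [NeZero r] in
theorem parity_add_two_mul (h2 : 2 ∣ r) (x y : ZMod r) :
    parity h2 (y + 2 * x) = parity h2 y := by
  rw [map_add, map_mul, map_ofNat, show (2 : ZMod 2) = 0 from rfl, zero_mul, add_zero]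

/-- Halving is additive up to a carry `r / 2`. -/
theorem half_add_two_mul (h2 : 2 ∣ r) (x y : ZMod r) :
    half (y + 2 * x) =
      x + half y - if r / 2 ≤ (x + half y).val then ((r / 2 : ℕ) : ZMod r) else 0 := by
  set q := (x + half y).val with hq
  have hqr : q < r := ZMod.val_lt _
  have hxq : x + half y = (q : ZMod r) := (ZMod.natCast_zmod_val _).symm
  have hy : y = ((2 * (y.val / 2) + y.val % 2 : ℕ) : ZMod r) := by
    rw [Nat.div_add_mod, ZMod.natCast_zmod_val]
  have h1 : y + 2 * x = ((2 * q + y.val % 2 : ℕ) : ZMod r) := by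
    conv_lhs => rw [hy]
    push_cast
    rw [← hxq, half]
    ring
  have hm : y.val % 2 < 2 := Nat.mod_lt _ two_pos
  rw [hxq, h1, half, ZMod.val_natCast]
  split_ifs with h
  · have h3 : (2 * q + y.val % 2) % r = 2 * q + y.val % 2 - r := by
      rw [Nat.mod_eq_sub_mod (by omega), Nat.mod_eq_of_lt (by omega)]
    rw [h3, eq_sub_iff_add_eq, ← Nat.cast_add]
    congr 1
    omega
  · rw [Nat.mod_eq_of_lt (by omega), sub_zero]
    congr 1
    omega

/-- Adding `r / 2` exchanges the lower and the upper half of the residues. -/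
theorem half_le_val_add_half (h2 : 2 ∣ r) (z : ZMod r) :
    r / 2 ≤ (z + (r / 2 : ℕ)).val ↔ ¬r / 2 ≤ z.val := by
  have hz := ZMod.val_lt z
  have hr := NeZero.pos r
  rw [ZMod.val_add, ZMod.val_natCast, Nat.mod_eq_of_lt (show r / 2 < r by omega)]
  by_cases h : r / 2 ≤ z.val
  · rw [Nat.mod_eq_sub_mod (by omega), Nat.mod_eq_of_lt (by omega)]
    omega
  · rw [Nat.mod_eq_of_lt (by omega)]
    omega

omit [NeZero r] in
theorem fixParity_conj {p : ℕ} {h : WreathProd r n} (hh : h ∈ ReflGroup r p n)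
    (ω : WreathProd r n) : fixParity p (h * ω * h.transpose) = fixParity p ω := by
  have : 2 * delta h ∈ AddSubgroup.zmultiples ((2 * p : ℕ) : ZMod r) := by
    obtain ⟨k, hk⟩ := ReflGroup.mem_iff.1 hh
    refine ⟨k, ?_⟩
    rw [← hk]
    simp only [zsmul_eq_mul]
    push_cast
    ring
  simp only [fixParity, delta_conj, AddSubgroup.add_mem_cancel_right _ this]

/-- The sign `(-1) ^ |B̃(g,ω)|` is a cocycle for twisted conjugation: twisted conjugation by `h`
replaces `k` by `k + z_h(i)` modulo `r / 2`, and the signs record the carries. -/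
theorem fixSign_mul (h2 : 2 ∣ r) {p : ℕ} (g : WreathProd r n) {h : WreathProd r n}
    (hh : h ∈ ReflGroup r p n) (ω : WreathProd r n) :
    (-1 : ℚ) ^ (modB p (g * h) ω).card =
      (-1) ^ (modB p g (h * ω * h.transpose)).card * (-1) ^ (modB p h ω).card := by
  classical
  have key (g ω : WreathProd r n) : (-1 : ℚ) ^ (modB p g ω).card =
      ∏ i, if i ∈ modB p g ω then -1 else 1 := by
    rw [← neg_one_pow_card_filter]
    simp
  rw [key, key, key, ← Equiv.prod_comp h.perm (fun i => if i ∈ modB p g _ then (-1 : ℚ) else 1),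
    ← Finset.prod_mul_distrib]
  refine Finset.prod_congr rfl fun i _ => ?_
  have hmem : h.perm i ∈ modB p g (h * ω * h.transpose) ↔
      (ω.perm i = i ∧ parity h2 (ω.z i + h.z i + h.z (ω.perm i)) = fixParity p ω) ∧
        r / 2 ≤ (g.z (h.perm i) + half (ω.z i + h.z i + h.z (ω.perm i))).val := by
    rw [mem_modB h2, conj_z, conj_perm, fixParity_conj hh]
    simp
  simp only [hmem]
  simp only [mem_modB h2, mul_z]
  by_cases hi : ω.perm i = i
  · have hz : ω.z i + h.z i + h.z i = ω.z i + 2 * h.z i := by ring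
    simp only [hi, hz, parity_add_two_mul, true_and]
    by_cases hp : parity h2 (ω.z i) = fixParity p ω
    · simp only [hp, true_and]
      rw [half_add_two_mul h2]
      have ha := half_le_val_add_half h2
        (g.z (h.perm i) + (h.z i + half (ω.z i) - ((r / 2 : ℕ) : ZMod r)))
      by_cases hc : r / 2 ≤ (h.z i + half (ω.z i)).val
      · simp only [hc, if_true]
        rw [← add_sub_assoc, sub_add_cancel, ← add_assoc] at ha
        rw [← add_sub_assoc, ← add_assoc]
        simp only [ha]
        split_ifs <;> simp
      · simp only [hc, if_false, sub_zero, add_assoc, mul_one]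
    · simp only [hp, false_and, if_false, mul_one]
  · simp [hi]

theorem modB_one (h2 : 2 ∣ r) (p : ℕ) (ω : WreathProd r n) : modB p 1 ω = ∅ := by
  refine Finset.eq_empty_of_forall_notMem fun i hi => ?_
  have h := ((mem_modB h2).1 hi).2
  have hv := ZMod.val_lt (ω.z i)
  rw [one_z, zero_add, half, ZMod.val_natCast, Nat.mod_eq_of_lt (by omega)] at h
  omega

theorem modSign_mul (h2 : 2 ∣ r) {p : ℕ} (g : WreathProd r n) {h : WreathProd r n}
    (hh : h ∈ ReflGroup r p n) {ω : WreathProd r n} (hω : ω.transpose = ω) :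
    modSign p (g * h) ω = modSign p g (h * ω * h.transpose) * modSign p h ω := by
  rw [modSign_eq, modSign_eq, modSign_eq, fixSign_mul h2 g hh, mul_perm,
    pairSign_mul _ _ (perm_perm_of_transpose_eq hω), conj_perm]
  ring

theorem modSign_one (h2 : 2 ∣ r) (p : ℕ) {ω : WreathProd r n} (hω : ω.transpose = ω) :
    modSign p 1 ω = 1 := by
  rw [modSign_eq, modB_one h2, one_perm, pairSign_one (perm_perm_of_transpose_eq hω)]
  simp

end FixSign

end WreathProd

namespace SymElem

open WreathProd

variable {r p n : ℕ}

theorem conj_one (ω : SymElem r p n) : ω.conj 1 = ω := by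
  refine Subtype.ext (Subtype.ext ?_)
  simp only [conj]
  ext <;> simp [transpose_eq]

theorem conj_mul (g h : ReflGroup r p n) (ω : SymElem r p n) :
    ω.conj (g * h) = (ω.conj h).conj g := by
  refine Subtype.ext (Subtype.ext ?_)
  simp only [conj, Subgroup.coe_mul, transpose_mul, mul_assoc]

variable [NeZero r]

/-- The signed permutation representation on the symmetric elements. -/
noncomputable def rep (h2 : 2 ∣ r) : Representation ℚ (ReflGroup r p n) (SymSpace r p n) where
  toFun g := Finsupp.linearCombination ℚ fun ω =>
    modSign p (g : WreathProd r n) (ω.1 : WreathProd r n) • Finsupp.single (ω.conj g) 1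
  map_one' := by
    ext1 ω
    ext1
    simp [modSign_one h2 p ω.2, conj_one]
  map_mul' g h := by
    ext1 ω
    ext1
    simp only [LinearMap.comp_apply, Finsupp.lsingle_apply, Finsupp.linearCombination_single,
      Module.End.mul_apply, map_smul, smul_smul]
    rw [conj_mul, Subgroup.coe_mul, modSign_mul h2 _ h.2 ω.2]
    simp only [one_mul]
    rw [mul_comm]
    rfl

theorem rep_single (h2 : 2 ∣ r) (g : ReflGroup r p n) (ω : SymElem r p n) :
    rep h2 g (Finsupp.single ω 1) =
      modSign p (g : WreathProd r n) (ω.1 : WreathProd r n) • Finsupp.single (ω.conj g) 1 := by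
  simp [rep]

end SymElem

/-! ### Solutions of the fixed point equation for a given involution -/

namespace Equiv.Perm

section HalfCycle

variable {α : Type*} {π σ : Perm α}

theorem SameCycle.map_commute (hc : ∀ i, σ (π i) = π (σ i)) {i j : α} (h : π.SameCycle i j) :
    π.SameCycle (σ i) (σ j) := by
  obtain ⟨k, rfl⟩ := h
  have : Commute σ π := Equiv.ext hc
  exact ⟨k, by rw [← mul_apply, ← mul_apply, (this.zpow_right k).eq]⟩

theorem sameCycle_map_iff (hσ : ∀ i, σ (σ i) = i) (hc : ∀ i, σ (π i) = π (σ i)) {i j : α} :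
    π.SameCycle (σ i) (σ j) ↔ π.SameCycle i j :=
  ⟨fun h => by simpa [hσ] using h.map_commute hc, fun h => h.map_commute hc⟩

/-- If the involution `σ` commutes with `π` and preserves the cycle of `i` without fixing `i`, then
the first half `i, π i, …, π ^ (m - 1) i` of this cycle meets each pair `{j, σ j}` in the cycle
exactly once. -/
theorem exists_half_cycle [Finite α] (hσ : ∀ i, σ (σ i) = i) (hc : ∀ i, σ (π i) = π (σ i)) {i : α}
    (hi : π.SameCycle i (σ i)) (hne : σ i ≠ i) :
    ∃ m : ℕ, (π ^ m) i = σ i ∧ Set.InjOn (fun t : ℕ => (π ^ t) i) (Set.Iio m) ∧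
      ∀ j, π.SameCycle i j →
        ((∃ t < m, (π ^ t) i = σ j) ↔ ¬∃ t < m, (π ^ t) i = j) := by
  classical
  have hex : ∃ m : ℕ, 0 < m ∧ (π ^ m) i = σ i := by
    obtain ⟨m, hm, -, h⟩ := hi.exists_pow_eq''
    exact ⟨m, hm, h⟩
  let m := Nat.find hex
  obtain ⟨hm0, hm⟩ : 0 < m ∧ (π ^ m) i = σ i := Nat.find_spec hex
  have hmin (d : ℕ) (hd : 0 < d) (hdm : d < m) : (π ^ d) i ≠ σ i := fun h =>
    Nat.find_min hex hdm ⟨hd, h⟩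
  have hcomm (t : ℕ) (j : α) : σ ((π ^ t) j) = (π ^ t) (σ j) := by
    have : Commute σ π := Equiv.ext hc
    rw [← mul_apply, (this.pow_right t).eq, mul_apply]
  have hadd (s t : ℕ) : (π ^ s) ((π ^ t) i) = (π ^ (s + t)) i := by rw [pow_add, mul_apply]
  have hper (d : ℕ) (hd : 0 < d) (hdm : d < m) : (π ^ d) i ≠ i := fun h => by
    refine hmin (m - d) (by omega) (by omega) ?_
    rw [← hm]
    conv_lhs => rw [← h]
    rw [hadd]
    congr 2
    omega
  have hcancel (s t : ℕ) (hst : s ≤ t) (j : α) (h : (π ^ s) j = (π ^ t) i) :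
      j = (π ^ (t - s)) i := by
    rw [show t = s + (t - s) by omega, ← hadd] at h
    exact (π ^ s).injective h
  refine ⟨m, hm, ?_, fun j hj => ⟨?_, ?_⟩⟩
  · have aux (s t : ℕ) (hst : s < t) (ht : t < m) : (π ^ s) i ≠ (π ^ t) i := fun h =>
      hper (t - s) (by omega) (by omega) (hcancel s t hst.le i h).symm
    intro s hs t ht h
    rcases lt_trichotomy s t with hst | hst | hst
    · exact (aux s t hst ht h).elim
    · exact hst
    · exact (aux t s hst hs h.symm).elim
  · rintro ⟨s, hs, h1⟩ ⟨t, ht, h2⟩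
    -- here `π ^ s i = σ (π ^ t i)`
    rw [← h2, hcomm] at h1
    rcases lt_trichotomy s t with hst | hst | hst
    · have h4 := congrArg σ h1
      rw [hcomm, hcomm, hσ] at h4
      rw [show t = s + (t - s) by omega, ← hadd] at h4
      exact hmin (t - s) (by omega) (by omega) ((π ^ s).injective h4).symm
    · rw [hst] at h1
      exact hne ((π ^ t).injective h1).symm
    · exact hmin (s - t) (by omega) (by omega) (hcancel t s hst.le _ h1.symm).symm
  · intro h
    have h2m : (π ^ (2 * m)) i = i := by rw [two_mul, ← hadd, hm, ← hcomm, hm, hσ]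
    obtain ⟨k, -, hk⟩ := hj.exists_pow_eq'
    have hk' : (π ^ (k % (2 * m))) i = j := by
      conv_rhs => rw [← hk, ← Nat.mod_add_div k (2 * m), pow_add, pow_mul, mul_apply,
        Function.IsFixedPt.perm_pow (e := π ^ (2 * m)) h2m _]
    have hlt : k % (2 * m) < 2 * m := Nat.mod_lt _ (by omega)
    by_cases hkm : k % (2 * m) < m
    · exact (h ⟨_, hkm, hk'⟩).elim
    · refine ⟨k % (2 * m) - m, by omega, ?_⟩
      rw [← hk', show k % (2 * m) = (k % (2 * m) - m) + m by omega, ← hadd, hm, ← hcomm, hσ]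
      congr 2
      omega

end HalfCycle

section Coboundary

variable {α A : Type*} [Fintype α] [AddCommGroup A] {π σ : Perm α} {x : α → A}

/-- The condition on the sums `S` of `x` over the cycles of `π` under which `x` is compatible with
`σ`: `S` vanishes on cycles preserved by `σ`, and is opposite on cycles exchanged by `σ`. It
depends only on the action of `σ` on the cycles of `π`. -/
def Balanced (π : Perm α) (x : α → A) (σ : Perm α) : Prop :=
  ∀ i, (π.SameCycle i (σ i) → π.cycleSum x i = 0) ∧
    (¬π.SameCycle i (σ i) → π.cycleSum x i + π.cycleSum x (σ i) = 0)

theorem balanced_congr {σ' : Perm α} (h : ∀ i, π.SameCycle (σ i) (σ' i)) :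
    Balanced π x σ ↔ Balanced π x σ' := by
  refine forall_congr' fun i => ?_
  have : π.SameCycle i (σ i) ↔ π.SameCycle i (σ' i) :=
    ⟨fun h' => h'.trans (h i), fun h' => h'.trans (h i).symm⟩
  rw [this, cycleSum_congr (h i)]

/-- The functions `y` for which `(y, σ)` is symmetric and fixed by the twisted conjugation with
`(x, π)`. -/
def IsTwistedFixed (π : Perm α) (x : α → A) (σ : Perm α) (y : α → A) : Prop :=
  (∀ i, y (σ i) = y i) ∧ ∀ i, y (π i) = y i + x i + x (σ i)

theorem cycleSum_comp_commute (hσ : ∀ i, σ (σ i) = i) (hc : ∀ i, σ (π i) = π (σ i)) (w : α → A)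
    (i : α) : π.cycleSum (fun j => w (σ j)) i = π.cycleSum w (σ i) :=
  cycleSum_comp (π' := π) σ w i fun _ => (sameCycle_map_iff hσ hc).symm

theorem IsTwistedFixed.cycleSum_add_eq_zero (hσ : ∀ i, σ (σ i) = i) (hc : ∀ i, σ (π i) = π (σ i))
    {y : α → A} (hy : IsTwistedFixed π x σ y) (i : α) :
    π.cycleSum x i + π.cycleSum x (σ i) = 0 := by
  rw [← cycleSum_comp_commute hσ hc, ← cycleSum_add]
  refine (exists_sub_eq_iff _).1 ⟨y, fun j => ?_⟩ i
  rw [hy.2]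
  abel

/-- On a cycle which `σ` preserves but does not fix pointwise, `y` takes the same value at `i` and
at `σ i`, which is half a cycle away; the increments of `y` in between add up to the sum of `x`
over the cycle. -/
theorem IsTwistedFixed.cycleSum_eq_zero (hσ : ∀ i, σ (σ i) = i) (hc : ∀ i, σ (π i) = π (σ i))
    {y : α → A} (hy : IsTwistedFixed π x σ y) {i : α} (hi : π.SameCycle i (σ i)) (hne : σ i ≠ i) :
    π.cycleSum x i = 0 := by
  classical
  obtain ⟨m, hm, hinj, hQ⟩ := exists_half_cycle hσ hc hi hne
  have hstep (t : ℕ) : y ((π ^ t) i) =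
      y i + ∑ s ∈ Finset.range t, (x ((π ^ s) i) + x (σ ((π ^ s) i))) := by
    induction t with
    | zero => simp
    | succ t ih =>
      rw [pow_succ', mul_apply, hy.2, ih, Finset.sum_range_succ]
      abel
  have h0 := hstep m
  rw [hm, hy.1, left_eq_add] at h0
  rw [← h0, cycleSum, ← Finset.sum_filter_add_sum_filter_not _ fun j => ∃ t < m, (π ^ t) i = j,
    Finset.sum_add_distrib]
  congr 1
  · refine (Finset.sum_bij (fun t _ => (π ^ t) i) (fun t ht => ?_) (fun s hs t ht h => ?_)
      (fun j hj => ?_) fun _ _ => rfl).symm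
    · simp only [Finset.mem_filter, Finset.mem_univ, true_and]
      exact ⟨⟨t, by simp⟩, t, Finset.mem_range.1 ht, rfl⟩
    · exact hinj (Finset.mem_range.1 hs) (Finset.mem_range.1 ht) h
    · obtain ⟨t, ht, h⟩ := (Finset.mem_filter.1 hj).2
      exact ⟨t, Finset.mem_range.2 ht, h⟩
  · refine (Finset.sum_bij (fun t _ => σ ((π ^ t) i)) (fun t ht => ?_) (fun s hs t ht h => ?_)
      (fun j hj => ?_) fun _ _ => rfl).symm
    · have h1 : π.SameCycle i (σ ((π ^ t) i)) :=
        hi.trans (SameCycle.map_commute hc ⟨t, by simp⟩)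
      simp only [Finset.mem_filter, Finset.mem_univ, true_and]
      exact ⟨h1, (hQ _ h1).1 ⟨t, Finset.mem_range.1 ht, (hσ _).symm⟩⟩
    · exact hinj (Finset.mem_range.1 hs) (Finset.mem_range.1 ht) (σ.injective h)
    · simp only [Finset.mem_filter, Finset.mem_univ, true_and] at hj
      obtain ⟨t, ht, h⟩ := (hQ _ hj.1).2 hj.2
      exact ⟨t, Finset.mem_range.2 ht, by rw [h, hσ]⟩

theorem exists_isTwistedFixed [LinearOrder α] (hσ : ∀ i, σ (σ i) = i)
    (hc : ∀ i, σ (π i) = π (σ i)) (h : Balanced π x σ) : ∃ y, IsTwistedFixed π x σ y := by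
  classical
  -- on two exchanged cycles, the whole increment of `y` is put on one of them
  let x' (i : α) : A := if π.SameCycle i (σ i) then x i else
    if π.cycleRep i < π.cycleRep (σ i) then x i + x (σ i) else 0
  have hsame {i j : α} (hij : π.SameCycle i j) : π.SameCycle i (σ i) ↔ π.SameCycle j (σ j) :=
    ⟨fun h' => hij.symm.trans (h'.trans (hij.map_commute hc)),
      fun h' => hij.trans (h'.trans (hij.map_commute hc).symm)⟩
  have hrep {i j : α} (hij : π.SameCycle i j) : π.cycleRep i = π.cycleRep j ∧
      π.cycleRep (σ i) = π.cycleRep (σ j) :=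
    ⟨π.cycleRep_eq_iff.2 hij, π.cycleRep_eq_iff.2 (hij.map_commute hc)⟩
  obtain ⟨v, hv⟩ := (exists_sub_eq_iff (π := π) x').2 fun i => by
    by_cases hi : π.SameCycle i (σ i)
    · rw [← (h i).1 hi]
      exact cycleSum_ext fun j hj => if_pos ((hsame hj).1 hi)
    by_cases hlt : π.cycleRep i < π.cycleRep (σ i)
    · rw [← (h i).2 hi, ← cycleSum_comp_commute hσ hc, ← cycleSum_add]
      refine cycleSum_ext fun j hj => ?_
      simp only [x', ← hsame hj, hi, ← (hrep hj).1, ← (hrep hj).2, hlt, if_true, if_false]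
    · rw [← show π.cycleSum (fun _ => (0 : A)) i = 0 by simp [cycleSum]]
      refine cycleSum_ext fun j hj => ?_
      simp only [x', ← hsame hj, hi, ← (hrep hj).1, ← (hrep hj).2, hlt, if_false]
  refine ⟨fun i => v i + v (σ i), fun i => ?_, fun i => ?_⟩
  · change v (σ i) + v (σ (σ i)) = v i + v (σ i)
    rw [hσ, add_comm]
  have hx : x' i + x' (σ i) = x i + x (σ i) := by
    have h1 : π.SameCycle (σ i) (σ (σ i)) ↔ π.SameCycle i (σ i) := sameCycle_map_iff hσ hc
    by_cases hi : π.SameCycle i (σ i)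
    · simp only [x', h1, hi, if_true]
    · have hne : π.cycleRep i ≠ π.cycleRep (σ i) := fun h' => hi (π.cycleRep_eq_iff.1 h')
      have hi' : ¬π.SameCycle (σ i) i := fun h' => hi h'.symm
      simp only [x', hi, hi', if_false, hσ]
      rcases lt_or_gt_of_ne hne with h2 | h2 <;> simp [h2, h2.not_gt, add_comm]
  change v (π i) + v (σ (π i)) = v i + v (σ i) + x i + x (σ i)
  rw [hc, ← sub_add_cancel (v (π i)) (v i), hv, ← sub_add_cancel (v (π (σ i))) (v (σ i)), hv]
  rw [add_assoc (v i + v (σ i)), ← hx]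
  abel

/-- For a square root `t` of `π`, the compatibility condition says that `x` is a coboundary for the
action of `t`. -/
theorem balanced_iff_of_sq {t : Perm α} (ht : t * t = π) :
    Balanced π x t ↔ ∃ u : α → A, ∀ i, u (t i) - u i = x i := by
  classical
  rw [exists_sub_eq_iff]
  have ht' (i) : t (t i) = π i := by rw [← ht, mul_apply]
  have hpow (k : ℤ) : t ^ (2 * k) = π ^ k := by rw [zpow_mul, zpow_two, ht]
  have hS (i j : α) : t.SameCycle i j ↔ π.SameCycle i j ∨ π.SameCycle (t i) j := by
    constructor
    · rintro ⟨k, rfl⟩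
      rcases Int.even_or_odd' k with ⟨a, rfl | rfl⟩
      · exact Or.inl ⟨a, by rw [hpow]⟩
      · exact Or.inr ⟨a, by rw [zpow_add, hpow, mul_apply, zpow_one]⟩
    · rintro (⟨a, rfl⟩ | ⟨a, rfl⟩)
      · exact ⟨2 * a, by rw [hpow]⟩
      · exact ⟨2 * a + 1, by rw [zpow_add, hpow, mul_apply, zpow_one]⟩
  refine forall_congr' fun i => ?_
  by_cases hi : π.SameCycle i (t i)
  · have h1 : t.cycleSum x i = π.cycleSum x i :=
      Finset.sum_congr (Finset.filter_congr fun j _ => by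
        rw [hS]; exact ⟨fun h => h.elim id hi.trans, Or.inl⟩) fun _ _ => rfl
    simp [hi, h1]
  · have h1 : t.cycleSum x i = π.cycleSum x i + π.cycleSum x (t i) := by
      simp only [cycleSum, hS]
      rw [Finset.filter_or, Finset.sum_union]
      exact Finset.disjoint_filter.2 fun j _ h h' => hi (h.trans h'.symm)
    simp [hi, h1]

end Coboundary

end Equiv.Perm

/-! ### Cancellation of the involutions preserving a cycle of even length -/

namespace Equiv.Perm

section Period

variable {α : Type*} (π : Perm α)

open Function

theorem pow_apply_eq_self_iff_dvd (k : ℕ) (i : α) :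
    (π ^ k) i = i ↔ minimalPeriod π i ∣ k := by
  rw [← isPeriodicPt_iff_minimalPeriod_dvd, IsPeriodicPt, iterate_eq_pow]
  rfl

theorem minimalPeriod_pos [Finite α] (i : α) : 0 < minimalPeriod π i := by
  refine minimalPeriod_pos_of_mem_periodicPts ⟨orderOf π, orderOf_pos π, ?_⟩
  rw [IsPeriodicPt, iterate_eq_pow, pow_orderOf_eq_one]
  rfl

variable {π}

theorem SameCycle.minimalPeriod_eq {i j : α} (h : π.SameCycle i j) :
    minimalPeriod π i = minimalPeriod π j := by
  obtain ⟨z, rfl⟩ := h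
  have key (k : ℕ) : (π ^ k) ((π ^ z) i) = (π ^ z) i ↔ (π ^ k) i = i := by
    rw [← mul_apply, ← zpow_natCast, (Commute.refl π).zpow_zpow k z |>.eq, mul_apply,
      (π ^ z).injective.eq_iff]
  refine Nat.dvd_antisymm ?_ ?_
  · rw [← pow_apply_eq_self_iff_dvd, ← key, pow_apply_eq_self_iff_dvd]
  · rw [← pow_apply_eq_self_iff_dvd, key, pow_apply_eq_self_iff_dvd]

end Period

section Weight

variable {α : Type*} [Fintype α] {A : Type*} [AddCommGroup A]

open Classical in
/-- The number of functions invariant under `π` and `σ` if `x` is compatible with `σ`, and `0`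
otherwise. -/
noncomputable def weight (π : Perm α) (x : α → A) (σ : Perm α) : ℚ :=
  if Balanced π x σ then Nat.card {f : α → A // ∀ i, f (π i) = f i ∧ f (σ i) = f i} else 0

/-- The invariant functions are constant on the cycles of `π`, so only the action of `σ` on the
cycles matters. -/
theorem weight_congr {π : Perm α} {x : α → A} {σ σ' : Perm α}
    (h : ∀ i, π.SameCycle (σ i) (σ' i)) : weight π x σ = weight π x σ' := by
  have key (f : α → A) : (∀ i, f (π i) = f i ∧ f (σ i) = f i) ↔
      ∀ i, f (π i) = f i ∧ f (σ' i) = f i := by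
    refine forall_and.trans (Iff.trans (and_congr_right fun hf => ?_) forall_and.symm)
    have hconst {i j : α} (hij : π.SameCycle i j) : f i = f j := by
      obtain ⟨k, -, rfl⟩ := hij.exists_pow_eq'
      induction k with
      | zero => rfl
      | succ k ih => rw [pow_succ', mul_apply, hf, ← ih ⟨k, by simp⟩]
    exact forall_congr' fun i => by rw [hconst (h i)]
  by_cases hb : Balanced π x σ
  · have hb' := (balanced_congr h).1 hb
    simp only [weight, hb, hb', key, if_true]
  · have hb' := mt (balanced_congr h).2 hb
    simp only [weight, hb, hb', if_false]

end Weight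

variable {n : ℕ} {π σ : Perm (Fin n)}

open Function WreathProd

/-- `σ` is an involution which commutes with `π`. -/
def IsCommInvol (π σ : Perm (Fin n)) : Prop :=
  (∀ i, σ (σ i) = i) ∧ ∀ i, σ (π i) = π (σ i)

/-- The cycle of `π` through `i` has even length and is preserved by `σ`. -/
def IsEvenPreserved (π σ : Perm (Fin n)) (i : Fin n) : Prop :=
  π.SameCycle i (σ i) ∧ Even (minimalPeriod π i)

section Toggle

theorem pow_apply_comm (hc : ∀ i, σ (π i) = π (σ i)) (t : ℕ) (i : Fin n) :
    σ ((π ^ t) i) = (π ^ t) (σ i) := by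
  have : Commute σ π := Equiv.ext hc
  rw [← mul_apply, (this.pow_right t).eq, mul_apply]

/-- Going along half of a cycle turns a pair `{i, σ i}` around. -/
theorem prod_invSign_half_cycle (hσ : IsCommInvol π σ) {i : Fin n} (hne : σ i ≠ i) {m : ℕ}
    (hm : (π ^ m) i = σ i) :
    ∏ t ∈ Finset.range m, invSign π ((π ^ t) i) (σ ((π ^ t) i)) = -1 := by
  let o (t : ℕ) : ℚ := if (π ^ t) i < σ ((π ^ t) i) then 1 else -1
  have hoo (t : ℕ) : o t * o t = 1 := by simp only [o]; split_ifs <;> norm_num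
  have hstep (t : ℕ) : ∏ s ∈ Finset.range t, invSign π ((π ^ s) i) (σ ((π ^ s) i)) = o t * o 0 := by
    induction t with
    | zero => simp [hoo]
    | succ t ih =>
      have : invSign π ((π ^ t) i) (σ ((π ^ t) i)) = o (t + 1) * o t := by
        simp only [invSign, o, pow_succ', mul_apply, hσ.2]
        split_ifs <;> simp_all
      rw [Finset.prod_range_succ, ih, this, mul_comm, mul_assoc, ← mul_assoc (o t), hoo, one_mul]
  rw [hstep]
  simp only [o, hm, hσ.1, pow_zero, one_apply]
  rcases lt_or_gt_of_ne hne with h | h <;> simp [h, h.not_gt]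

/-- Switching from the identity to a fixed point free involution on a cycle of `π` changes the
sign. -/
theorem pairSign_eq_neg_of_fixes_cycle {σ' : Perm (Fin n)} (hσ : IsCommInvol π σ)
    (hσ' : IsCommInvol π σ') {i : Fin n} (hi : π.SameCycle i (σ' i)) (hne : σ' i ≠ i)
    (hC : ∀ j, π.SameCycle i j → σ j = j) (hC' : ∀ j, ¬π.SameCycle i j → σ' j = σ j) :
    pairSign π σ' = -pairSign π σ := by
  classical
  obtain ⟨m, hm, hinj, hQ⟩ := exists_half_cycle hσ'.1 hσ'.2 hi hne
  have hmem {j : Fin n} : π.SameCycle i (σ' j) ↔ π.SameCycle i j :=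
    ⟨fun h => (sameCycle_map_iff hσ'.1 hσ'.2).1 (hi.symm.trans h),
      fun h => hi.trans (h.map_commute hσ'.2)⟩
  let P (j : Fin n) : Prop := if π.SameCycle i j then ∃ t < m, (π ^ t) i = j else j < σ j
  have hlt (j : Fin n) (hj : σ j ≠ j) : σ j < σ (σ j) ↔ ¬j < σ j := by
    rw [hσ.1, not_lt, le_iff_lt_or_eq]; simp [hj]
  rw [pairSign_eq_prod hσ'.1 π P fun j hj => ?_, pairSign_eq_prod hσ.1 π (fun j => j < σ j) hlt,
    ← Finset.prod_filter_mul_prod_filter_not _ fun j => π.SameCycle i j]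
  · rw [← neg_one_mul]
    congr 1
    · rw [← prod_invSign_half_cycle hσ' hne hm]
      refine (Finset.prod_bij (fun t _ => (π ^ t) i) (fun t ht => ?_) (fun s hs t ht h => ?_)
        (fun j hj => ?_) fun _ _ => rfl).symm
      · have h1 : π.SameCycle i ((π ^ t) i) := ⟨t, by simp⟩
        simp only [Finset.mem_filter, Finset.mem_univ, true_and, P, if_pos h1]
        refine ⟨⟨fun h => hne ?_, t, Finset.mem_range.1 ht, rfl⟩, h1⟩
        rw [pow_apply_comm hσ'.2] at h
        exact (π ^ t).injective h
      · exact hinj (Finset.mem_range.1 hs) (Finset.mem_range.1 ht) h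
      · simp only [Finset.mem_filter, Finset.mem_univ, true_and, P] at hj
        rw [if_pos hj.2] at hj
        obtain ⟨t, ht, h⟩ := hj.1.2
        exact ⟨t, Finset.mem_range.2 ht, h⟩
    · refine Finset.prod_congr (Finset.ext fun j => ?_) fun j hj => ?_
      · simp only [Finset.mem_filter, Finset.mem_univ, true_and, P]
        by_cases hj : π.SameCycle i j
        · simp [hj, hC j hj]
        · simp [hj, hC' j hj]
      · have h1 : ¬π.SameCycle i j := fun h => (Finset.mem_filter.1 hj).2.1 (hC j h)
        rw [hC' j h1]
  · by_cases h : π.SameCycle i j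
    · simp only [P, hmem, if_pos h]
      exact hQ j h
    · have h1 := mt hmem.1 h
      rw [hC' j h] at h1 ⊢
      simp only [P, if_neg h, if_neg h1]
      exact hlt j (hC' j h ▸ hj)

open Classical in
/-- The `m`-th power of `π` on the cycle of `π` through `i`, and the identity elsewhere. -/
noncomputable def cyclePow (π : Perm (Fin n)) (i : Fin n) (m : ℕ) : Perm (Fin n) :=
  π.cycleOf i ^ m

theorem cyclePow_apply {i j : Fin n} (h : π.SameCycle i j) (m : ℕ) :
    cyclePow π i m j = (π ^ m) j := by
  classical
  induction m generalizing j with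
  | zero => rfl
  | succ m ih =>
    rw [cyclePow, pow_succ, mul_apply, h.cycleOf_apply, pow_succ, mul_apply]
    exact ih (h.trans ⟨1, by simp⟩)

theorem cyclePow_apply_of_not {i j : Fin n} (h : ¬π.SameCycle i j) (m : ℕ) :
    cyclePow π i m j = j := by
  classical
  exact IsFixedPt.perm_pow (cycleOf_apply_of_not_sameCycle h) m

theorem sameCycle_cyclePow (i j : Fin n) (m : ℕ) : π.SameCycle j (cyclePow π i m j) := by
  by_cases h : π.SameCycle i j
  · rw [cyclePow_apply h]
    exact ⟨m, by simp⟩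
  · rw [cyclePow_apply_of_not h]

variable {i : Fin n} {m : ℕ}

theorem IsCommInvol.mul_cyclePow (hσ : IsCommInvol π σ) (hi : π.SameCycle i (σ i))
    (hm : minimalPeriod π i = 2 * m) : IsCommInvol π (σ * cyclePow π i m) := by
  have hmem {j : Fin n} (h : π.SameCycle i j) : π.SameCycle i (σ j) :=
    hi.trans (h.map_commute hσ.2)
  have hmem' {j : Fin n} (h : ¬π.SameCycle i j) : ¬π.SameCycle i (σ j) := fun h' =>
    h (by simpa [hσ.1] using hmem h')
  refine ⟨fun j => ?_, fun j => ?_⟩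
  · by_cases h : π.SameCycle i j
    · have h1 : π.SameCycle i (σ ((π ^ m) j)) := hmem (h.trans ⟨m, by simp⟩)
      rw [mul_apply, mul_apply, cyclePow_apply h, cyclePow_apply h1, pow_apply_comm hσ.2, hσ.1,
        ← mul_apply, ← pow_add, ← two_mul, pow_apply_eq_self_iff_dvd, ← h.minimalPeriod_eq, hm]
    · rw [mul_apply, mul_apply, cyclePow_apply_of_not h, cyclePow_apply_of_not (hmem' h), hσ.1]
  · by_cases h : π.SameCycle i j
    · rw [mul_apply, mul_apply, cyclePow_apply h, cyclePow_apply (h.trans ⟨1, by simp⟩),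
        ← hσ.2, ← mul_apply (π ^ m), ← mul_apply π, ← pow_succ, pow_succ']
    · have h1 : ¬π.SameCycle i (π j) := fun h' => h (h'.trans (SameCycle.symm ⟨1, by simp⟩))
      rw [mul_apply, mul_apply, cyclePow_apply_of_not h, cyclePow_apply_of_not h1, hσ.2]

theorem pairSign_mul_cyclePow (hσ : IsCommInvol π σ) (hi : π.SameCycle i (σ i))
    (hm : minimalPeriod π i = 2 * m) : pairSign π (σ * cyclePow π i m) = -pairSign π σ := by
  have hσ' := hσ.mul_cyclePow hi hm
  have hmpos : 0 < m := by have := minimalPeriod_pos π i; omega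
  have hmi : (π ^ m) i ≠ i := fun h => by
    have := Nat.le_of_dvd hmpos (hm ▸ (pow_apply_eq_self_iff_dvd π m i).1 h)
    omega
  have hcyc (j : Fin n) : π.SameCycle (σ j) ((σ * cyclePow π i m) j) :=
    (sameCycle_cyclePow i j m).map_commute hσ.2
  have hcomm {j : Fin n} (k : ℕ) (h : (π ^ k) i = σ i) (hj : π.SameCycle i j) :
      σ j = (π ^ k) j := by
    obtain ⟨l, -, rfl⟩ := hj.exists_pow_eq'
    rw [pow_apply_comm hσ.2, ← h, ← mul_apply, ← mul_apply, ← pow_add, ← pow_add, add_comm]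
  obtain ⟨k, -, hk⟩ := hi.exists_pow_eq'
  -- `σ` is the identity or `π ^ m` on the cycle
  have h2k : m ∣ k := by
    have : (π ^ (k + k)) i = i := by rw [pow_add, mul_apply, hk, ← pow_apply_comm hσ.2, hk, hσ.1]
    rw [pow_apply_eq_self_iff_dvd, hm, ← two_mul] at this
    exact Nat.dvd_of_mul_dvd_mul_left two_pos this
  obtain ⟨a, rfl⟩ := h2k
  have hσ'i : (σ * cyclePow π i m) i = (π ^ (m * a + m)) i := by
    rw [mul_apply, cyclePow_apply (SameCycle.refl _ _), pow_apply_comm hσ.2, ← hk,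
      ← mul_apply, ← pow_add, add_comm]
  rcases Nat.even_or_odd' a with ⟨b, rfl | rfl⟩
  · have hC (j : Fin n) (hj : π.SameCycle i j) : σ j = j := by
      rw [hcomm _ hk hj, pow_apply_eq_self_iff_dvd, ← hj.minimalPeriod_eq, hm]
      exact ⟨b, by ring⟩
    refine pairSign_eq_neg_of_fixes_cycle hσ hσ' (hi.trans (hcyc i)) ?_ hC fun j hj => ?_
    · rw [mul_apply, cyclePow_apply (SameCycle.refl _ _), pow_apply_comm hσ.2,
        hC i (SameCycle.refl _ _)]
      exact hmi
    · rw [mul_apply, cyclePow_apply_of_not hj]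
  · have hC (j : Fin n) (hj : π.SameCycle i j) : (σ * cyclePow π i m) j = j := by
      rw [mul_apply, cyclePow_apply hj, hcomm _ hk (hj.trans ⟨m, by simp⟩), ← mul_apply, ← pow_add,
        pow_apply_eq_self_iff_dvd, ← hj.minimalPeriod_eq, hm]
      exact ⟨b + 1, by ring⟩
    rw [pairSign_eq_neg_of_fixes_cycle hσ' hσ hi ?_ hC fun j hj => ?_, neg_neg]
    · rw [← hk]
      intro h
      rw [pow_apply_eq_self_iff_dvd, hm] at h
      obtain ⟨c, hc⟩ := h
      have : 2 * b + 1 = 2 * c := Nat.eq_of_mul_eq_mul_left hmpos (by rw [hc]; ring)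
      omega
    · rw [mul_apply, cyclePow_apply_of_not hj]

/-- An involution commuting with `π` is the identity on the cycles of odd length which it
preserves. -/
theorem IsCommInvol.apply_eq_self (hσ : IsCommInvol π σ) (hi : π.SameCycle i (σ i))
    (he : ¬IsEvenPreserved π σ i) : σ i = i := by
  have hodd : Odd (minimalPeriod π i) := Nat.not_even_iff_odd.1 fun h => he ⟨hi, h⟩
  obtain ⟨k, -, hk⟩ := hi.exists_pow_eq'
  have : (π ^ (k + k)) i = i := by rw [pow_add, mul_apply, hk, ← pow_apply_comm hσ.2, hk, hσ.1]
  rw [pow_apply_eq_self_iff_dvd, ← two_mul] at this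
  rw [← hk, pow_apply_eq_self_iff_dvd]
  exact (Nat.coprime_two_right.2 hodd).dvd_of_dvd_mul_left this

/-- If `σ` exchanges all cycles which it moves, the orientations of the pairs `{i, σ i}` with `i`
in the first of two exchanged cycles are permuted by `π`, so that their changes cancel. -/
theorem pairSign_eq_one (hσ : IsCommInvol π σ) (he : ∀ i, ¬IsEvenPreserved π σ i) :
    pairSign π σ = 1 := by
  have hrep {i : Fin n} (hi : σ i ≠ i) : π.cycleRep i ≠ π.cycleRep (σ i) := fun h =>
    hi (hσ.apply_eq_self (π.cycleRep_eq_iff.1 h) (he i))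
  rw [pairSign_eq_prod hσ.1 π (fun i => π.cycleRep i < π.cycleRep (σ i)) fun i hi => by
    rw [hσ.1, not_lt, le_iff_lt_or_eq]
    simp [(hrep hi).symm]]
  let o (j : Fin n) : ℚ := if j < σ j then 1 else -1
  have hstep (j : Fin n) : invSign π j (σ j) = o (π j) * o j := by
    simp only [invSign, o, hσ.2]
    split_ifs <;> simp_all
  have hperm : ∏ i with σ i ≠ i ∧ π.cycleRep i < π.cycleRep (σ i), o (π i) =
      ∏ i with σ i ≠ i ∧ π.cycleRep i < π.cycleRep (σ i), o i := by
    refine Finset.prod_equiv π (fun i => ?_) fun _ _ => rfl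
    have h1 (j : Fin n) : π.cycleRep (π j) = π.cycleRep j :=
      π.cycleRep_eq_iff.2 (SameCycle.symm ⟨1, by simp⟩)
    simp [hσ.2, h1]
  simp only [hstep]
  rw [Finset.prod_mul_distrib, hperm, ← Finset.prod_mul_distrib]
  refine Finset.prod_eq_one fun i _ => ?_
  simp only [o]
  split_ifs <;> norm_num

variable {A : Type*} [AddCommGroup A]

open Classical in
/-- In the signed sum over the involutions commuting with `π`, those which preserve a cycle of even
length cancel: on one such cycle, the identity can be exchanged with the rotation by half the length
of the cycle. -/
theorem sum_pairSign_mul_weight (π : Perm (Fin n)) (x : Fin n → A) :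
    ∑ σ with IsCommInvol π σ, pairSign π σ * weight π x σ =
      ∑ σ with IsCommInvol π σ ∧ ∀ i, ¬IsEvenPreserved π σ i, weight π x σ := by
  rw [← Finset.sum_filter_add_sum_filter_not _ fun σ => ∀ i, ¬IsEvenPreserved π σ i,
    Finset.filter_filter, Finset.filter_filter]
  have hzero : ∑ σ with IsCommInvol π σ ∧ ¬∀ i, ¬IsEvenPreserved π σ i,
      pairSign π σ * weight π x σ = 0 := by
    let pick (σ : Perm (Fin n)) : Perm (Fin n) :=
      if h : ∃ i, IsEvenPreserved π σ i then
        cyclePow π h.choose (minimalPeriod π h.choose / 2) else 1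
    have hpick (σ : Perm (Fin n)) (h : ¬∀ i, ¬IsEvenPreserved π σ i) : ∃ i m,
        IsEvenPreserved π σ i ∧ minimalPeriod π i = 2 * m ∧ pick σ = cyclePow π i m := by
      have h' : ∃ i, IsEvenPreserved π σ i := _root_.not_forall_not.1 h
      refine ⟨h'.choose, _, h'.choose_spec, ?_, dif_pos h'⟩
      exact (Nat.two_mul_div_two_of_even h'.choose_spec.2).symm
    have hcyc (σ : Perm (Fin n)) (hσ : IsCommInvol π σ) (h : ¬∀ i, ¬IsEvenPreserved π σ i)
        (j : Fin n) : π.SameCycle (σ j) ((σ * pick σ) j) := by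
      obtain ⟨i, m, -, -, hp⟩ := hpick σ h
      rw [hp]
      exact (sameCycle_cyclePow i j m).map_commute hσ.2
    have hev (σ : Perm (Fin n)) (hσ : IsCommInvol π σ) (h : ¬∀ i, ¬IsEvenPreserved π σ i) :
        IsEvenPreserved π (σ * pick σ) = IsEvenPreserved π σ := funext fun j => propext <|
      and_congr_left fun _ => ⟨fun h' => h'.trans (hcyc σ hσ h j).symm,
        fun h' => h'.trans (hcyc σ hσ h j)⟩
    have hpick' (σ : Perm (Fin n)) (hσ : IsCommInvol π σ) (h : ¬∀ i, ¬IsEvenPreserved π σ i) :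
        pick (σ * pick σ) = pick σ := by
      have := hev σ hσ h
      simp only [pick] at this ⊢
      simp only [this]
    have hmem (σ : Perm (Fin n)) (hσ : σ ∈ Finset.univ.filter fun σ =>
        IsCommInvol π σ ∧ ¬∀ i, ¬IsEvenPreserved π σ i) :
        IsCommInvol π σ ∧ ¬∀ i, ¬IsEvenPreserved π σ i := (Finset.mem_filter.1 hσ).2
    refine Finset.sum_involution (fun σ _ => σ * pick σ) (fun σ hσ => ?_) (fun σ hσ _ he => ?_)
      (fun σ hσ => ?_) fun σ hσ => ?_
    all_goals obtain ⟨hσ, h⟩ := hmem σ hσ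
    all_goals obtain ⟨i, m, hi, hm, hp⟩ := hpick σ h
    · rw [← weight_congr (hcyc σ hσ h), hp, pairSign_mul_cyclePow hσ hi.1 hm]
      ring
    · rw [mul_eq_left, hp] at he
      have h1 : (π ^ m) i = i := by
        rw [← cyclePow_apply (SameCycle.refl _ _), he, one_apply]
      have hpos := minimalPeriod_pos π i
      have := Nat.le_of_dvd (by omega) ((pow_apply_eq_self_iff_dvd π m i).1 h1)
      omega
    · rw [Finset.mem_filter, hev σ hσ h, hp]
      exact ⟨Finset.mem_univ _, hσ.mul_cyclePow hi.1 hm, h⟩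
    · rw [hpick' σ hσ h, mul_assoc, mul_eq_left, hp]
      refine Equiv.ext fun j => ?_
      rw [cyclePow, ← pow_add, ← two_mul]
      change cyclePow π i (2 * m) j = j
      by_cases hj : π.SameCycle i j
      · rw [cyclePow_apply hj, pow_apply_eq_self_iff_dvd, ← hj.minimalPeriod_eq, hm]
      · rw [cyclePow_apply_of_not hj]
  rw [hzero, add_zero]
  refine Finset.sum_congr rfl fun σ hσ => ?_
  rw [pairSign_eq_one (Finset.mem_filter.1 hσ).2.1 (Finset.mem_filter.1 hσ).2.2, one_mul]

end Toggle

end Equiv.Perm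

/-! ### Involutions and square roots -/

namespace Equiv.Perm

section SquareRoot

open Function

variable {n : ℕ} {π σ t : Perm (Fin n)} {i : Fin n}

theorem cycleRep_apply (π : Perm (Fin n)) (i : Fin n) : π.cycleRep (π i) = π.cycleRep i :=
  π.cycleRep_eq_iff.2 (SameCycle.symm ⟨1, by simp⟩)

theorem odd_of_sameCycle_of_sq (ht : ∀ i, t (t i) = π i) (hi : π.SameCycle i (t i)) :
    Odd (minimalPeriod π i) := by
  have hc (i : Fin n) : t (π i) = π (t i) := by rw [← ht, ← ht]
  obtain ⟨a, ha, -, h⟩ := hi.exists_pow_eq''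
  have h1 : (π ^ (a + a - 1)) i = i := by
    apply π.injective
    rw [← mul_apply, ← pow_succ', Nat.sub_add_cancel (by omega), pow_add, mul_apply, h,
      ← pow_apply_comm hc, h, ht]
  rw [pow_apply_eq_self_iff_dvd] at h1
  exact Odd.of_dvd_nat ⟨a - 1, by omega⟩ h1

/-- On a cycle of odd length `l`, the only square root of `π` preserving the cycle is
`π ^ ((l + 1) / 2)`. -/
theorem apply_eq_of_sameCycle_of_sq (ht : ∀ i, t (t i) = π i) (hi : π.SameCycle i (t i)) :
    t i = (π ^ ((minimalPeriod π i + 1) / 2)) i := by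
  obtain ⟨b, hb⟩ := odd_of_sameCycle_of_sq ht hi
  have hc (i : Fin n) : t (π i) = π (t i) := by rw [← ht, ← ht]
  obtain ⟨a, -, h⟩ := hi.exists_pow_eq'
  have htπ : t ^ 2 = π := Equiv.ext fun j => by rw [pow_two, mul_apply, ht]
  have hpow (k : ℕ) : (t ^ k) i = (π ^ (a * k)) i := by
    induction k with
    | zero => simp
    | succ k ih => rw [pow_succ', mul_apply, ih, pow_apply_comm hc, ← h, ← mul_apply, ← pow_add,
        mul_add_one]
  have h1 : (t ^ minimalPeriod π i) i = i := by
    rw [hpow, pow_apply_eq_self_iff_dvd]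
    exact dvd_mul_left _ _
  have h2 : (minimalPeriod π i + 1) / 2 * 2 = minimalPeriod π i + 1 := by omega
  conv_rhs => rw [← htπ]
  rw [← pow_mul, mul_comm, htπ, h2, pow_succ', mul_apply, h1]

open Classical in
/-- The square root of `π` attached to an involution `σ` commuting with `π` which preserves no cycle
of even length: on a pair of exchanged cycles, it is `σ` in one direction and `π σ` in the other. -/
noncomputable def sqrtFun (π σ : Perm (Fin n)) (i : Fin n) : Fin n :=
  if π.SameCycle i (σ i) then (π ^ ((minimalPeriod π i + 1) / 2)) i
  else if π.cycleRep i < π.cycleRep (σ i) then σ i else π (σ i)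

theorem sqrtFun_sqrtFun (hσ : IsCommInvol π σ) (he : ∀ i, ¬IsEvenPreserved π σ i) (i : Fin n) :
    sqrtFun π σ (sqrtFun π σ i) = π i := by
  by_cases hi : π.SameCycle i (σ i)
  · have hodd : Odd (minimalPeriod π i) := Nat.not_even_iff_odd.1 fun h => he i ⟨hi, h⟩
    have h1 : sqrtFun π σ i = (π ^ ((minimalPeriod π i + 1) / 2)) i := if_pos hi
    have h2 : π.SameCycle i (sqrtFun π σ i) := by rw [h1]; exact ⟨_, by rw [zpow_natCast]⟩
    have h3 : π.SameCycle (sqrtFun π σ i) (σ (sqrtFun π σ i)) :=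
      h2.symm.trans (hi.trans (h2.map_commute hσ.2))
    have h4 : sqrtFun π σ (sqrtFun π σ i) =
      (π ^ ((minimalPeriod π (sqrtFun π σ i) + 1) / 2)) (sqrtFun π σ i) := if_pos h3
    obtain ⟨b, hb⟩ := hodd
    rw [h4, ← h2.minimalPeriod_eq, h1, ← mul_apply, ← pow_add,
      show (minimalPeriod π i + 1) / 2 + (minimalPeriod π i + 1) / 2 = 1 + minimalPeriod π i by
        omega, pow_add, mul_apply, pow_one, (pow_apply_eq_self_iff_dvd π _ i).2 dvd_rfl]
  · have hi' : ¬π.SameCycle (σ i) i := fun h => hi h.symm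
    have hne : π.cycleRep i ≠ π.cycleRep (σ i) := fun h => hi (π.cycleRep_eq_iff.1 h)
    rcases lt_or_gt_of_ne hne with h | h
    · have h1 : sqrtFun π σ i = σ i := by simp [sqrtFun, hi, h]
      rw [h1]
      simp [sqrtFun, hσ.1, hi', h.not_gt]
    · have h1 : sqrtFun π σ i = π (σ i) := by simp [sqrtFun, hi, h.not_gt]
      rw [h1]
      simp [sqrtFun, hσ.1, hσ.2, hi', cycleRep_apply, h]

/-- The permutation given by `sqrtFun`. -/
noncomputable def sqrtPerm (hσ : IsCommInvol π σ) (he : ∀ i, ¬IsEvenPreserved π σ i) :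
    Perm (Fin n) where
  toFun := sqrtFun π σ
  invFun i := π⁻¹ (sqrtFun π σ i)
  left_inv i := by
    change π.symm (sqrtFun π σ (sqrtFun π σ i)) = i
    rw [sqrtFun_sqrtFun hσ he, symm_apply_apply]
  right_inv i := by
    have hc (j : Fin n) : sqrtFun π σ (π j) = π (sqrtFun π σ j) := by
      rw [← sqrtFun_sqrtFun hσ he j, sqrtFun_sqrtFun hσ he]
    apply π.injective
    rw [← hc]
    change sqrtFun π σ (π (π.symm (sqrtFun π σ i))) = π i
    rw [apply_symm_apply, sqrtFun_sqrtFun hσ he]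

theorem sameCycle_sqrtFun (hσ : IsCommInvol π σ) (he : ∀ i, ¬IsEvenPreserved π σ i) (i : Fin n) :
    π.SameCycle (σ i) (sqrtFun π σ i) := by
  unfold sqrtFun
  split_ifs with h1 h2
  · rw [hσ.apply_eq_self h1 (he i)]
    exact ⟨_, by rw [zpow_natCast]⟩
  · exact SameCycle.refl _ _
  · exact ⟨1, by simp⟩

open Classical in
/-- The involution attached to a square root `t` of `π`, inverse to `sqrtFun`. -/
noncomputable def involFun (π t : Perm (Fin n)) (i : Fin n) : Fin n :=
  if π.SameCycle i (t i) then i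
  else if π.cycleRep i < π.cycleRep (t i) then t i else π⁻¹ (t i)

theorem cycleRep_inv_apply (π : Perm (Fin n)) (i : Fin n) :
    π.cycleRep (π⁻¹ i) = π.cycleRep i := by
  conv_rhs => rw [← π.apply_symm_apply i, cycleRep_apply]
  rfl

theorem involFun_involFun (ht : ∀ i, t (t i) = π i) (i : Fin n) :
    involFun π t (involFun π t i) = i := by
  have hc (i : Fin n) : t (π i) = π (t i) := by rw [← ht, ← ht]
  by_cases hi : π.SameCycle i (t i)
  · simp [involFun, hi]
  · have hi' : ¬π.SameCycle (t i) i := fun h => hi h.symm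
    have hne : π.cycleRep i ≠ π.cycleRep (t i) := fun h => hi (π.cycleRep_eq_iff.1 h)
    rcases lt_or_gt_of_ne hne with h | h
    · have h1 : involFun π t i = t i := by simp [involFun, hi, h]
      rw [h1]
      simp [involFun, ht, hi', cycleRep_apply, h.not_gt]
    · have h1 : involFun π t i = π⁻¹ (t i) := by simp [involFun, hi, h.not_gt]
      have h2 : t (π⁻¹ (t i)) = i := by
        apply π.injective
        rw [← hc]
        exact (congrArg t (π.apply_symm_apply _)).trans (ht i)
      have h3 : ¬π.SameCycle (π⁻¹ (t i)) i := fun h => hi' (by simpa using h)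
      rw [h1]
      unfold involFun
      rw [h2, if_neg h3, cycleRep_inv_apply, if_pos h]

theorem involFun_comm (ht : ∀ i, t (t i) = π i) (i : Fin n) :
    involFun π t (π i) = π (involFun π t i) := by
  have hc (i : Fin n) : t (π i) = π (t i) := by rw [← ht, ← ht]
  by_cases hi : π.SameCycle i (t i)
  · simp [involFun, hc, hi]
  · by_cases h : π.cycleRep i < π.cycleRep (t i)
    · simp [involFun, hc, hi, cycleRep_apply, h]
    · simp [involFun, hc, hi, cycleRep_apply, h]

theorem sameCycle_involFun (i : Fin n) : π.SameCycle (t i) (involFun π t i) := by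
  unfold involFun
  split_ifs with h1 h2
  · exact h1.symm
  · exact SameCycle.refl _ _
  · exact ⟨-1, by simp⟩

/-- The permutation given by `involFun`. -/
noncomputable def involPerm (ht : ∀ i, t (t i) = π i) : Perm (Fin n) :=
  (show Function.Involutive (involFun π t) from involFun_involFun ht).toPerm

theorem involPerm_apply (ht : ∀ i, t (t i) = π i) (i : Fin n) :
    involPerm ht i = involFun π t i := rfl

theorem sqrtPerm_apply (hσ : IsCommInvol π σ) (he : ∀ i, ¬IsEvenPreserved π σ i) (i : Fin n) :
    sqrtPerm hσ he i = sqrtFun π σ i := rfl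

theorem isCommInvol_involPerm (ht : ∀ i, t (t i) = π i) : IsCommInvol π (involPerm ht) :=
  ⟨involFun_involFun ht, involFun_comm ht⟩

theorem not_isEvenPreserved_involPerm (ht : ∀ i, t (t i) = π i) (i : Fin n) :
    ¬IsEvenPreserved π (involPerm ht) i := fun h =>
  Nat.not_even_iff_odd.2 (odd_of_sameCycle_of_sq ht (h.1.trans (sameCycle_involFun i).symm)) h.2

variable {A : Type*} [AddCommGroup A]

open Classical in
/-- The signed sum over the involutions commuting with `π` is a sum over the square roots of
`π`. -/
theorem sum_pairSign_mul_weight_eq_sum_sq (π : Perm (Fin n)) (x : Fin n → A) :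
    ∑ σ with IsCommInvol π σ, WreathProd.pairSign π σ * weight π x σ =
      ∑ t with t * t = π, weight π x t := by
  rw [sum_pairSign_mul_weight]
  have hsq {t : Perm (Fin n)} (ht : t ∈ Finset.univ.filter fun t => t * t = π) (i : Fin n) :
      t (t i) = π i := by rw [← (Finset.mem_filter.1 ht).2, mul_apply]
  refine Finset.sum_bij'
    (fun σ hσ => sqrtPerm (Finset.mem_filter.1 hσ).2.1 (Finset.mem_filter.1 hσ).2.2)
    (fun t ht => involPerm (hsq ht)) (fun σ hσ => ?_) (fun t ht => ?_) (fun σ hσ => ?_)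
    (fun t ht => ?_) fun σ hσ => ?_
  · obtain ⟨-, hσ, he⟩ := Finset.mem_filter.1 hσ
    rw [Finset.mem_filter]
    exact ⟨Finset.mem_univ _, Equiv.ext fun i => sqrtFun_sqrtFun hσ he i⟩
  · rw [Finset.mem_filter]
    exact ⟨Finset.mem_univ _, isCommInvol_involPerm _, not_isEvenPreserved_involPerm _⟩
  · obtain ⟨-, hσ, he⟩ := Finset.mem_filter.1 hσ
    refine Equiv.ext fun i => ?_
    rw [involPerm_apply, involFun, sqrtPerm_apply]
    have hs := sameCycle_sqrtFun hσ he i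
    have hiff : π.SameCycle i (sqrtFun π σ i) ↔ π.SameCycle i (σ i) :=
      ⟨fun h => h.trans hs.symm, fun h => h.trans hs⟩
    simp only [hiff, ← π.cycleRep_eq_iff.2 hs]
    unfold sqrtFun
    split_ifs with h1 h2
    · exact (hσ.apply_eq_self h1 (he i)).symm
    · rfl
    · exact π.symm_apply_apply _
  · have ht' := hsq ht
    refine Equiv.ext fun i => ?_
    rw [sqrtPerm_apply, sqrtFun, involPerm_apply]
    have hs := sameCycle_involFun (π := π) (t := t) i
    have hiff : π.SameCycle i (involFun π t i) ↔ π.SameCycle i (t i) :=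
      ⟨fun h => h.trans hs.symm, fun h => h.trans hs⟩
    simp only [hiff, ← π.cycleRep_eq_iff.2 hs]
    unfold involFun
    split_ifs with h1 h2
    · exact (apply_eq_of_sameCycle_of_sq ht' h1).symm
    · rfl
    · exact π.apply_symm_apply _
  · obtain ⟨-, hσ, he⟩ := Finset.mem_filter.1 hσ
    exact weight_congr fun i => sameCycle_sqrtFun hσ he i

end SquareRoot

end Equiv.Perm

/-! ### The signed sum over the vectors for a given involution -/

theorem Equiv.Perm.sum_eq_zero_of_cycleSum_eq_zero {α A : Type*} [Fintype α] [AddCommGroup A]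
    {π : Equiv.Perm α} {x : α → A} (S : Finset α) (hS : ∀ i, i ∈ S ↔ π i ∈ S)
    (h : ∀ i ∈ S, π.cycleSum x i = 0) : ∑ i ∈ S, x i = 0 := by
  classical
  have hS' {i j : α} (hij : π.SameCycle i j) : i ∈ S ↔ j ∈ S := by
    obtain ⟨k, -, rfl⟩ := hij.exists_pow_eq'
    induction k with
    | zero => rfl
    | succ k ih => rw [pow_succ', mul_apply, ← hS, ← ih ⟨k, by simp⟩]
  obtain ⟨v, hv⟩ := (exists_sub_eq_iff (π := π) fun i => if i ∈ S then x i else 0).2 fun i => by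
    by_cases hi : i ∈ S
    · rw [← h i hi]
      exact cycleSum_ext fun j hj => if_pos ((hS' hj).1 hi)
    · exact (cycleSum_ext (w := fun _ => 0) fun j hj => if_neg (mt (hS' hj).2 hi)).trans
        (by simp [cycleSum])
  rw [← Fintype.sum_ite_mem, ← Finset.sum_congr rfl fun i _ => hv i, Finset.sum_sub_distrib,
    Equiv.sum_comp, sub_self]

namespace WreathProd

open Equiv.Perm

variable {r n p : ℕ} [NeZero r]

section Count

omit [NeZero r] in
theorem sum_add_const (y : Fin n → ZMod r) (c : ZMod r) :
    ∑ i, (y i + c) = ∑ i, y i + n * c := by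
  simp [Finset.sum_add_distrib]

open Classical in
/-- In a set of vectors which is stable under adding constants, the sums of the coordinates are
equidistributed modulo `p`, as `p` is coprime to the number of coordinates. -/
theorem mul_card_filter_sum_mem (hpr : p ∣ r) (hgcd : Nat.gcd p n = 1)
    (Y : Finset (Fin n → ZMod r)) (hY : ∀ y c, y ∈ Y → (fun i => y i + c) ∈ Y) :
    p * (Y.filter fun y => ∑ i, y i ∈ AddSubgroup.zmultiples (p : ZMod r)).card = Y.card := by
  have : NeZero p := ⟨fun h => NeZero.ne r (Nat.eq_zero_of_zero_dvd (h ▸ hpr))⟩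
  rw [Finset.card_eq_sum_card_fiberwise (s := Y)
    (f := fun y => ZMod.castHom hpr (ZMod p) (∑ i, y i)) (t := Finset.univ)
    fun _ _ => Finset.mem_coe.2 (Finset.mem_univ _)]
  rw [Finset.sum_congr rfl (g := fun _ =>
    (Y.filter fun y => ∑ i, y i ∈ AddSubgroup.zmultiples (p : ZMod r)).card) fun a _ => ?_]
  · simp [ZMod.card]
  · obtain ⟨c, hc⟩ := ReflGroup.exists_add_mul_mem_zmultiples hgcd (a.val : ZMod r)
    rw [ZMod.mem_zmultiples_natCast_iff hpr, map_add, map_natCast, ZMod.natCast_zmod_val] at hc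
    refine Finset.card_bij' (fun y _ i => y i + c) (fun y _ i => y i + -c) (fun y hy => ?_)
      (fun y hy => ?_) (fun y _ => by simp) fun y _ => by simp
    · obtain ⟨h1, h2⟩ := Finset.mem_filter.1 hy
      refine Finset.mem_filter.2 ⟨hY y c h1, ?_⟩
      rw [ZMod.mem_zmultiples_natCast_iff hpr, sum_add_const, map_add, h2, hc]
    · obtain ⟨h1, h2⟩ := Finset.mem_filter.1 hy
      refine Finset.mem_filter.2 ⟨hY y (-c) h1, ?_⟩
      rw [ZMod.mem_zmultiples_natCast_iff hpr] at h2
      rw [sum_add_const, map_add, h2, mul_neg, map_neg, zero_add]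
      exact (eq_neg_of_add_eq_zero_left hc).symm

end Count

section FixSum

variable {g : WreathProd r n} {σ : Equiv.Perm (Fin n)} {y : Fin n → ZMod r}

omit [NeZero r] in
theorem two_mul_sum_eq_zero (hy : IsTwistedFixed g.perm g.z σ y) (S : Finset (Fin n))
    (hS : ∀ i, i ∈ S ↔ g.perm i ∈ S) (hfix : ∀ i ∈ S, σ i = i) : 2 * ∑ i ∈ S, g.z i = 0 := by
  have h1 : ∑ i ∈ S, y (g.perm i) = ∑ i ∈ S, y i :=
    Finset.sum_equiv g.perm hS fun _ _ => rfl
  have h2 : ∑ i ∈ S, y (g.perm i) = ∑ i ∈ S, y i + 2 * ∑ i ∈ S, g.z i := by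
    rw [Finset.mul_sum, ← Finset.sum_add_distrib]
    refine Finset.sum_congr rfl fun i hi => ?_
    rw [hy.2, hfix i hi]
    ring
  rw [h1] at h2
  simpa using h2

/-- The carries at the fixed points of `σ` add up to the sum of the coordinates of `g` at the
contributing fixed points. -/
theorem half_mul_card_modB (h2 : 2 ∣ r) (hσ : IsCommInvol g.perm σ)
    (hy : IsTwistedFixed g.perm g.z σ y) :
    ((r / 2 : ℕ) : ZMod r) * (modB p g ⟨y, σ⟩).card =
      ∑ i with σ i = i ∧ parity h2 (y i) = fixParity p ⟨y, σ⟩, g.z i := by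
  classical
  set S := Finset.univ.filter fun i => σ i = i ∧ parity h2 (y i) = fixParity p ⟨y, σ⟩ with hSdef
  have hstep (i : Fin n) (hi : σ i = i) : y (g.perm i) = y i + 2 * g.z i := by
    rw [hy.2, hi]
    ring
  have hS (i : Fin n) : i ∈ S ↔ g.perm i ∈ S := by
    simp only [hSdef, Finset.mem_filter, Finset.mem_univ, true_and, hσ.2, g.perm.injective.eq_iff]
    refine and_congr_right fun hi => ?_
    rw [hstep i hi, parity_add_two_mul]
  have h1 : ∑ i ∈ S, half (y (g.perm i)) = ∑ i ∈ S, half (y i) :=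
    Finset.sum_equiv g.perm hS fun _ _ => rfl
  have h3 : ∑ i ∈ S, half (y (g.perm i)) = ∑ i ∈ S, g.z i + ∑ i ∈ S, half (y i) -
      ∑ i ∈ S, if r / 2 ≤ (g.z i + half (y i)).val then ((r / 2 : ℕ) : ZMod r) else 0 := by
    rw [← Finset.sum_add_distrib, ← Finset.sum_sub_distrib]
    refine Finset.sum_congr rfl fun i hi => ?_
    rw [hstep i (Finset.mem_filter.1 hi).2.1, half_add_two_mul h2]
  have h4 : modB p g ⟨y, σ⟩ = S.filter fun i => r / 2 ≤ (g.z i + half (y i)).val := by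
    ext i
    rw [mem_modB h2, Finset.mem_filter, hSdef, Finset.mem_filter]
    simp
  rw [← Finset.sum_filter, ← h4, Finset.sum_const, nsmul_eq_mul, h1] at h3
  linear_combination h3

/-- The sign which is `1` at `0` and `-1` at all other elements. It is multiplicative on the
elements of order two in `ℤ_r`. -/
def zeroSign (s : ZMod r) : ℚ := if s = 0 then 1 else -1

theorem eq_half_of_two_mul_eq_zero {s : ZMod r} (hs : 2 * s = 0) (h0 : s ≠ 0) :
    s = ((r / 2 : ℕ) : ZMod r) := by
  have hlt := ZMod.val_lt s
  have hpos : 0 < s.val := Nat.pos_of_ne_zero fun h => h0 ((ZMod.val_eq_zero s).1 h)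
  have h1 : ((2 * s.val : ℕ) : ZMod r) = 0 := by
    push_cast
    rw [ZMod.natCast_zmod_val, hs]
  obtain ⟨k, hk⟩ := (ZMod.natCast_eq_zero_iff _ _).1 h1
  have : k = 1 := by
    have h3 : r * k < r * 2 := by omega
    have h4 : k < 2 := Nat.lt_of_mul_lt_mul_left h3
    rcases Nat.eq_zero_or_pos k with rfl | h
    · omega
    · omega
  rw [← ZMod.natCast_zmod_val s]
  congr 1
  subst this
  omega

theorem zeroSign_add {s t : ZMod r} (hs : 2 * s = 0) (ht : 2 * t = 0) :
    zeroSign (s + t) = zeroSign s * zeroSign t := by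
  by_cases hs0 : s = 0
  · simp [zeroSign, hs0]
  by_cases ht0 : t = 0
  · simp [zeroSign, ht0]
  have : s + t = 0 := by
    rw [eq_half_of_two_mul_eq_zero hs hs0, ← eq_half_of_two_mul_eq_zero ht ht0, ← two_mul, ht]
  simp [zeroSign, this, hs0, ht0]

/-- The sign depends only on a sum of coordinates of `g`, which is `0` or `r / 2`. -/
theorem neg_one_pow_card_modB (h2 : 2 ∣ r) (hσ : IsCommInvol g.perm σ)
    (hy : IsTwistedFixed g.perm g.z σ y) :
    (-1 : ℚ) ^ (modB p g ⟨y, σ⟩).card =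
      zeroSign (∑ i with σ i = i ∧ parity h2 (y i) = fixParity p ⟨y, σ⟩, g.z i) := by
  rw [← half_mul_card_modB h2 hσ hy, zeroSign]
  have h0 : ((r / 2 : ℕ) : ZMod r) * (2 : ℕ) = 0 := by
    rw [← Nat.cast_mul, Nat.div_mul_cancel h2, ZMod.natCast_self]
  have h1 : ((r / 2 : ℕ) : ZMod r) ≠ 0 := by
    have := NeZero.pos r
    rw [Ne, ZMod.natCast_eq_zero_iff]
    intro h
    have := Nat.le_of_dvd (by omega) h
    omega
  rcases Nat.even_or_odd' (modB p g ⟨y, σ⟩).card with ⟨k, hk | hk⟩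
  · rw [hk, Nat.cast_mul, ← mul_assoc, h0, zero_mul, if_pos rfl, pow_mul]
    norm_num
  · rw [hk, Nat.cast_add, Nat.cast_mul, mul_add, ← mul_assoc, h0, zero_mul, zero_add, Nat.cast_one,
      mul_one, if_neg h1, pow_add, pow_mul]
    norm_num

end FixSum

section Cancel

variable (g : WreathProd r n) (σ : Equiv.Perm (Fin n))

open Classical in
/-- The signed sum over the vectors `y` for which `(y, σ)` is a symmetric element of `G(r,p,n)`
fixed by `g`. -/
noncomputable def fixSignSum (p : ℕ) : ℚ :=
  ∑ y with IsTwistedFixed g.perm g.z σ y ∧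
    ∑ i, y i ∈ AddSubgroup.zmultiples (p : ZMod r), (-1 : ℚ) ^ (modB p g ⟨y, σ⟩).card

variable {g σ}

theorem zmod_two_add_eq_iff : ∀ a s e κ : ZMod 2, a + s = e + κ ↔ (a = e ↔ ¬s + κ = 1) := by
  decide

/-- If adding the vector `s` preserves the solutions `y`, shifts the relevant parity by `κ`, and
thereby flips the contribution of a set of fixed points over which `g` has nonzero sum, then the
signed sum vanishes. -/
theorem fixSignSum_eq_zero_of_shift (h2 : 2 ∣ r) (hσ : IsCommInvol g.perm σ) (s : Fin n → ZMod r)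
    (hsσ : ∀ i, s (σ i) = s i) (hsπ : ∀ i, s (g.perm i) = s i)
    (hs : ∑ i, s i ∈ AddSubgroup.zmultiples (p : ZMod r)) (κ : ZMod 2)
    (hκ : ∀ y : Fin n → ZMod r, ∑ i, y i ∈ AddSubgroup.zmultiples (p : ZMod r) →
      fixParity p ⟨y + s, σ⟩ = fixParity p ⟨y, σ⟩ + κ)
    (hne : ∑ i with σ i = i ∧ parity h2 (s i) + κ = 1, g.z i ≠ 0) : fixSignSum g σ p = 0 := by
  classical
  have hshift (y : Fin n → ZMod r) :
      IsTwistedFixed g.perm g.z σ (y + s) ↔ IsTwistedFixed g.perm g.z σ y := by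
    simp only [IsTwistedFixed, Pi.add_apply, hsσ, hsπ, add_left_inj]
    refine and_congr_right fun _ => forall_congr' fun i => ?_
    rw [add_right_comm (y i), add_right_comm _ (s i), add_left_inj]
  have hsign (y : Fin n → ZMod r) (hy : IsTwistedFixed g.perm g.z σ y)
      (hp : ∑ i, y i ∈ AddSubgroup.zmultiples (p : ZMod r)) :
      (-1 : ℚ) ^ (modB p g ⟨y + s, σ⟩).card = -(-1 : ℚ) ^ (modB p g ⟨y, σ⟩).card := by
    rw [neg_one_pow_card_modB h2 hσ hy, neg_one_pow_card_modB h2 hσ ((hshift y).2 hy), hκ y hp]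
    set e := fixParity p ⟨y, σ⟩
    have hpar (i : Fin n) (hi : σ i = i) : parity h2 (y (g.perm i)) = parity h2 (y i) := by
      rw [hy.2, hi, add_assoc, ← two_mul, parity_add_two_mul]
    have hfix (i : Fin n) : σ (g.perm i) = g.perm i ↔ σ i = i := by
      rw [hσ.2, g.perm.injective.eq_iff]
    have hM : 2 * ∑ i with σ i = i ∧ parity h2 (y i) = e, g.z i = 0 := by
      refine two_mul_sum_eq_zero hy _ (fun i => ?_) fun i hi => (Finset.mem_filter.1 hi).2.1
      simp only [Finset.mem_filter, Finset.mem_univ, true_and, hfix]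
      exact and_congr_right fun hi => by rw [hpar i hi]
    have hF : 2 * ∑ i with σ i = i ∧ parity h2 (s i) + κ = 1, g.z i = 0 := by
      refine two_mul_sum_eq_zero hy _ (fun i => ?_) fun i hi => (Finset.mem_filter.1 hi).2.1
      simp only [Finset.mem_filter, Finset.mem_univ, true_and, hfix, hsπ]
    have hMF : 2 * ∑ i with σ i = i ∧ parity h2 (y i) = e ∧ parity h2 (s i) + κ = 1, g.z i = 0 := by
      refine two_mul_sum_eq_zero hy _ (fun i => ?_) fun i hi => (Finset.mem_filter.1 hi).2.1
      simp only [Finset.mem_filter, Finset.mem_univ, true_and, hfix, hsπ]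
      exact and_congr_right fun hi => by rw [hpar i hi]
    -- the new contributing set is the symmetric difference of the old one with the flipped set
    have hsum : ∑ i with σ i = i ∧ parity h2 ((y + s) i) = e + κ, g.z i =
        ∑ i with σ i = i ∧ parity h2 (y i) = e, g.z i +
          ∑ i with σ i = i ∧ parity h2 (s i) + κ = 1, g.z i := by
      rw [← add_zero (∑ i with σ i = i ∧ parity h2 ((y + s) i) = e + κ, g.z i), ← hMF,
        Finset.mul_sum]
      simp only [Finset.sum_filter]
      rw [← Finset.sum_add_distrib, ← Finset.sum_add_distrib]
      refine Finset.sum_congr rfl fun i _ => ?_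
      simp only [Pi.add_apply, map_add, zmod_two_add_eq_iff]
      by_cases hi : σ i = i <;> by_cases h3 : parity h2 (y i) = e <;>
        by_cases h4 : parity h2 (s i) + κ = 1 <;> simp only [hi, h3, h4] <;> simp
      ring
    rw [hsum, zeroSign_add hM hF]
    rw [show zeroSign (∑ i with σ i = i ∧ parity h2 (s i) + κ = 1, g.z i) = -1 from if_neg hne]
    ring
  have hneg : fixSignSum g σ p = -fixSignSum g σ p := by
    conv_rhs => rw [fixSignSum]
    conv_lhs => rw [fixSignSum]
    rw [← Finset.sum_neg_distrib]
    refine (Finset.sum_equiv (Equiv.addRight s) (fun y => ?_) fun y hy => ?_).symm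
    · simp only [Finset.mem_filter, Finset.mem_univ, true_and, Equiv.coe_addRight, hshift]
      simp only [Pi.add_apply, Finset.sum_add_distrib, AddSubgroup.add_mem_cancel_right _ hs]
    · obtain ⟨-, h3, h4⟩ := Finset.mem_filter.1 hy
      exact (hsign y h3 h4).symm
  linarith

/-- A fixed point of `σ` on a cycle of `g` with nonzero sum makes the signed sum vanish. The shift
is by the constant `p` if `g` has nonzero sum over all fixed points of `σ`, and otherwise by the
indicator function of the cycle, corrected by a constant to preserve the sum modulo `2 * p`. -/
theorem fixSignSum_eq_zero (hp : 0 < p) (h2pr : 2 * p ∣ r) (hp2 : Even p) (hgcd : Nat.gcd p n = 1)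
    (hσ : IsCommInvol g.perm σ) {i₀ : Fin n} (hi₀ : σ i₀ = i₀)
    (hS : g.perm.cycleSum g.z i₀ ≠ 0) : fixSignSum g σ p = 0 := by
  classical
  have h2 : 2 ∣ r := dvd_of_mul_right_dvd h2pr
  have hodd : ¬2 ∣ n := fun h => by
    have := Nat.dvd_gcd hp2.two_dvd h
    rw [hgcd] at this
    omega
  by_cases hF : ∑ i with σ i = i, g.z i = 0
  · have hgcd2 : Nat.gcd (2 * p) n = 1 :=
      Nat.Coprime.mul_left ((Nat.Prime.coprime_iff_not_dvd Nat.prime_two).2 hodd) hgcd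
    obtain ⟨c, hc⟩ := ReflGroup.exists_add_mul_mem_zmultiples (r := r) hgcd2
      (∑ i, if g.perm.SameCycle i₀ i then (1 : ZMod r) else 0)
    rw [← sum_add_const] at hc
    have hle : AddSubgroup.zmultiples ((2 * p : ℕ) : ZMod r) ≤
        AddSubgroup.zmultiples (p : ZMod r) := by
      rw [AddSubgroup.zmultiples_le]
      exact ⟨2, by simp⟩
    refine fixSignSum_eq_zero_of_shift h2 hσ
      (fun i => (if g.perm.SameCycle i₀ i then (1 : ZMod r) else 0) + c) (fun i => ?_)
      (fun i => by simp) (hle hc) 0 (fun y _ => ?_) ?_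
    · have : g.perm.SameCycle i₀ (σ i) ↔ g.perm.SameCycle i₀ i := by
        conv_lhs => rw [← hi₀, sameCycle_map_iff hσ.1 hσ.2]
      simp only [this]
    · simp only [fixParity, delta, Pi.add_apply, add_zero]
      simp only [Finset.sum_add_distrib (f := y), AddSubgroup.add_mem_cancel_right _ hc]
    · have hcyc : ∑ i with σ i = i ∧ g.perm.SameCycle i₀ i, g.z i = g.perm.cycleSum g.z i₀ := by
        refine Finset.sum_congr (Finset.ext fun i => ?_) fun _ _ => rfl
        simp only [Finset.mem_filter, Finset.mem_univ, true_and]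
        refine ⟨fun h => h.2, fun h => ⟨?_, h⟩⟩
        obtain ⟨k, -, rfl⟩ := h.exists_pow_eq'
        rw [pow_apply_comm hσ.2, hi₀]
      have hcase : parity h2 c = 0 ∨ parity h2 c = 1 := by
        generalize parity h2 c = a
        revert a
        decide
      rcases hcase with h | h
      · rw [Finset.filter_congr (q := fun i => σ i = i ∧ g.perm.SameCycle i₀ i) fun i _ => ?_, hcyc]
        · exact hS
        · refine and_congr_right fun _ => ?_
          rw [map_add, h]
          split_ifs with h3
          · simp only [h3, map_one, add_zero]
          · simp [h3]
      · rw [Finset.filter_congr (q := fun i => σ i = i ∧ ¬g.perm.SameCycle i₀ i) fun i _ => ?_]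
        · intro h3
          rw [← Finset.sum_filter_add_sum_filter_not _ fun i => g.perm.SameCycle i₀ i,
            Finset.filter_filter, Finset.filter_filter, h3, add_zero, hcyc] at hF
          exact hS hF
        · refine and_congr_right fun _ => ?_
          rw [map_add, h]
          split_ifs with h3
          · rw [map_one]
            simp only [h3, not_true_eq_false, iff_false]
            decide
          · simp [h3]
  · have hpar : parity h2 (p : ZMod r) = 0 := by
      rw [map_natCast, ZMod.natCast_eq_zero_iff]
      exact hp2.two_dvd
    have hsum (y : Fin n → ZMod r) : ∑ i, (y i + (p : ZMod r)) = ∑ i, y i + n * p :=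
      sum_add_const y p
    have hkey (k : ℤ) : (k * p : ZMod r) ∈ AddSubgroup.zmultiples ((2 * p : ℕ) : ZMod r) ↔
        Even k := by
      constructor
      · rintro ⟨j, hj⟩
        simp only [zsmul_eq_mul] at hj
        have h3 : ((k * p - j * (2 * p) : ℤ) : ZMod r) = 0 := by
          push_cast at hj ⊢
          rw [hj, sub_self]
        rw [ZMod.intCast_zmod_eq_zero_iff_dvd] at h3
        have h4 : (2 * p : ℤ) ∣ k * p - j * (2 * p) :=
          dvd_trans (by exact_mod_cast Int.natCast_dvd_natCast.2 h2pr) h3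
        have h5 : (2 * p : ℤ) ∣ k * p := (dvd_sub_left (dvd_mul_left _ _)).1 h4
        exact even_iff_two_dvd.2 (Int.dvd_of_mul_dvd_mul_right (by exact_mod_cast hp.ne') h5)
      · rintro ⟨j, rfl⟩
        refine ⟨j, ?_⟩
        simp only [zsmul_eq_mul]
        push_cast
        ring
    refine fixSignSum_eq_zero_of_shift h2 hσ (fun _ => (p : ZMod r)) (fun _ => rfl) (fun _ => rfl)
      ⟨n, by simp⟩ 1 (fun y hy => ?_) ?_
    · obtain ⟨k, hk⟩ := hy
      simp only [zsmul_eq_mul] at hk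
      have h3 : delta (⟨y + fun _ => (p : ZMod r), σ⟩ : WreathProd r n) =
          ((k + n : ℤ) : ZMod r) * p := by
        simp only [delta, Pi.add_apply, hsum, ← hk]
        push_cast
        ring
      have h4 : delta (⟨y, σ⟩ : WreathProd r n) = (k : ZMod r) * p := hk.symm
      have h5 : Even (k + n : ℤ) ↔ ¬Even k := by
        rw [Int.even_add, Int.even_coe_nat, even_iff_two_dvd (a := n)]
        simp [hodd]
      simp only [fixParity, h3, h4, hkey, h5]
      split_ifs <;> simp_all
      decide
    · simpa [hpar] using hF

end Cancel

section Evaluate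

variable {g : WreathProd r n} {σ : Equiv.Perm (Fin n)}

/-- The signed sum over the vectors `y` only depends on the action of `σ` on the cycles of `g`. -/
theorem mul_fixSignSum (hp : 0 < p) (h2pr : 2 * p ∣ r) (hp2 : Even p) (hgcd : Nat.gcd p n = 1)
    (hσ : IsCommInvol g.perm σ) : p * fixSignSum g σ p = weight g.perm g.z σ := by
  classical
  have h2 : 2 ∣ r := dvd_of_mul_right_dvd h2pr
  have hpr : p ∣ r := dvd_of_mul_left_dvd h2pr
  by_cases hbad : ∃ i, σ i = i ∧ g.perm.cycleSum g.z i ≠ 0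
  · obtain ⟨i, hi, hS⟩ := hbad
    rw [fixSignSum_eq_zero hp h2pr hp2 hgcd hσ hi hS, mul_zero, weight, if_neg fun h => hS ?_]
    exact (h i).1 (by rw [hi])
  push Not at hbad
  let Y := Finset.univ.filter fun y => IsTwistedFixed g.perm g.z σ y
  have hsum : p * fixSignSum g σ p = (Y.card : ℚ) := by
    rw [← mul_card_filter_sum_mem hpr hgcd Y, Nat.cast_mul, fixSignSum, Finset.filter_filter,
      Finset.sum_congr rfl (g := fun _ => (1 : ℚ)) fun y hy => ?_]
    · simp
    · have hy' := (Finset.mem_filter.1 hy).2.1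
      rw [neg_one_pow_card_modB h2 hσ hy', zeroSign, if_pos]
      refine sum_eq_zero_of_cycleSum_eq_zero (π := g.perm) _ (fun i => ?_) fun i hi =>
        hbad i (Finset.mem_filter.1 hi).2.1
      simp only [Finset.mem_filter, Finset.mem_univ, true_and, hσ.2, g.perm.injective.eq_iff]
      refine and_congr_right fun hi => ?_
      rw [hy'.2, hi, add_assoc, ← two_mul, parity_add_two_mul]
    · intro y c hy
      have hy' := (Finset.mem_filter.1 hy).2
      refine Finset.mem_filter.2 ⟨Finset.mem_univ _, fun i => by simp only [hy'.1], fun i => ?_⟩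
      simp only [hy'.2]
      abel
  rw [hsum, weight]
  by_cases hY : ∃ y, IsTwistedFixed g.perm g.z σ y
  · obtain ⟨y₀, hy₀⟩ := hY
    have hb : Balanced g.perm g.z σ := fun i => ⟨fun hi => ?_, fun _ =>
      hy₀.cycleSum_add_eq_zero hσ.1 hσ.2 i⟩
    · rw [if_pos hb, ← Fintype.card_subtype, ← Nat.card_eq_fintype_card]
      refine congrArg _ (Nat.card_congr ((Equiv.subRight y₀).subtypeEquiv fun y => ?_))
      simp only [IsTwistedFixed, Equiv.subRight_apply, Pi.sub_apply, ← forall_and, hy₀.1, hy₀.2]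
      refine forall_congr' fun i => ?_
      rw [and_comm, sub_left_inj, sub_eq_sub_iff_add_eq_add]
      refine and_congr_left fun _ => ?_
      rw [← sub_eq_zero, ← sub_eq_zero (a := y (g.perm i) + y₀ i)]
      refine Eq.congr_left ?_
      abel
    · by_cases hne : σ i = i
      · exact hbad i hne
      · exact hy₀.cycleSum_eq_zero hσ.1 hσ.2 hi hne
  · rw [if_neg fun h => hY (exists_isTwistedFixed hσ.1 hσ.2 h)]
    rw [Nat.cast_eq_zero, Finset.card_eq_zero, Finset.filter_eq_empty_iff]
    exact fun y _ hy => hY ⟨y, hy⟩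

end Evaluate

end WreathProd

/-! ### The character of the signed permutation representation -/

namespace WreathProd

open Equiv.Perm

variable {r n p : ℕ}

theorem transpose_eq_self_iff {ω : WreathProd r n} :
    ω.transpose = ω ↔ (∀ i, ω.perm (ω.perm i) = i) ∧ ∀ i, ω.z (ω.perm i) = ω.z i := by
  constructor
  · intro h
    refine ⟨perm_perm_of_transpose_eq h, fun i => ?_⟩
    have h1 := congrFun (congrArg z h) (ω.perm i)
    rw [transpose_eq] at h1
    simpa using h1.symm
  · rintro ⟨h1, h2⟩
    have h3 : ω.perm⁻¹ = ω.perm := mul_eq_one_iff_inv_eq.1 (Equiv.ext h1)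
    rw [transpose_eq, h3]
    ext i
    · exact h2 i
    · rfl

theorem conj_eq_self_iff {g ω : WreathProd r n} :
    g * ω * g.transpose = ω ↔ (∀ i, ω.perm (g.perm i) = g.perm (ω.perm i)) ∧
      ∀ i, ω.z (g.perm i) = ω.z i + g.z i + g.z (ω.perm i) := by
  have h1 : g.perm * ω.perm * g.perm⁻¹ = ω.perm ↔ ∀ i, ω.perm (g.perm i) = g.perm (ω.perm i) := by
    rw [mul_inv_eq_iff_eq_mul, Equiv.ext_iff]
    exact forall_congr' fun i => eq_comm
  constructor
  · intro h
    refine ⟨h1.1 (by rw [← conj_perm, h]), fun i => ?_⟩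
    rw [← conj_z, h]
  · rintro ⟨h2, h3⟩
    ext i
    · rw [← g.perm.apply_symm_apply i, conj_z, h3]
    · rw [conj_perm, h1.2 h2]

end WreathProd

namespace SymElem

open WreathProd Equiv.Perm

variable {r n p : ℕ} [NeZero r]

noncomputable instance : Fintype (SymElem r p n) := Fintype.ofFinite _

open Classical in
theorem trace_rep (h2 : 2 ∣ r) (g : ReflGroup r p n) :
    LinearMap.trace ℚ _ (rep h2 g) =
      ∑ ω : SymElem r p n with ω.conj g = ω,
        modSign p (g : WreathProd r n) (ω.1 : WreathProd r n) := by
  rw [LinearMap.trace_eq_matrix_trace ℚ Finsupp.basisSingleOne, Matrix.trace, Finset.sum_filter]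
  refine Finset.sum_congr rfl fun ω _ => ?_
  rw [Matrix.diag_apply, LinearMap.toMatrix_apply, Finsupp.coe_basisSingleOne, rep_single]
  simp [Finsupp.single_apply]

open Classical in
/-- The symmetric elements fixed by `g`, sorted by their permutation part. -/
theorem sum_modSign_eq (g : WreathProd r n) (hg : g ∈ ReflGroup r p n) :
    ∑ ω : SymElem r p n with ω.conj ⟨g, hg⟩ = ω, modSign p g (ω.1 : WreathProd r n) =
      ∑ σ with IsCommInvol g.perm σ, pairSign g.perm σ * fixSignSum g σ p := by
  have hiff (ω : WreathProd r n) : (ω.transpose = ω ∧ g * ω * g.transpose = ω) ↔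
      IsCommInvol g.perm ω.perm ∧ IsTwistedFixed g.perm g.z ω.perm ω.z := by
    rw [transpose_eq_self_iff, conj_eq_self_iff, IsCommInvol, IsTwistedFixed]
    tauto
  have hconj (ω : SymElem r p n) (h : ω.conj ⟨g, hg⟩ = ω) :
      g * ω.1 * g.transpose = (ω.1 : WreathProd r n) :=
    congrArg (fun ω : SymElem r p n => (ω.1 : WreathProd r n)) h
  simp only [fixSignSum, Finset.mul_sum]
  rw [Finset.sum_sigma']
  refine Finset.sum_bij (fun ω _ => ⟨(ω.1 : WreathProd r n).perm, (ω.1 : WreathProd r n).z⟩)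
    (fun ω hω => ?_) (fun ω _ ω' _ h => ?_) (fun a ha => ?_) fun ω _ => ?_
  · have h := (hiff ω.1).1 ⟨ω.2, hconj ω (Finset.mem_filter.1 hω).2⟩
    simp only [Finset.mem_sigma, Finset.mem_filter, Finset.mem_univ, true_and]
    exact ⟨h.1, h.2, ReflGroup.mem_iff.1 ω.1.2⟩
  · simp only [Sigma.mk.injEq, heq_eq_eq] at h
    refine Subtype.ext (Subtype.ext (WreathProd.ext h.2 ?_))
    exact h.1
  · simp only [Finset.mem_sigma, Finset.mem_filter, Finset.mem_univ, true_and] at ha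
    have h := (hiff ⟨a.2, a.1⟩).2 ⟨ha.1, ha.2.1⟩
    refine ⟨⟨⟨⟨a.2, a.1⟩, ReflGroup.mem_iff.2 ha.2.2⟩, h.1⟩, ?_, rfl⟩
    rw [Finset.mem_filter]
    exact ⟨Finset.mem_univ _, Subtype.ext (Subtype.ext h.2)⟩
  · rw [modSign_eq, mul_comm]

open Classical in
/-- The number of solutions of `h * h̄ = g` in `G(r,p,n)`, sorted by their permutation part, a
square root of that of `g`. -/
theorem mul_card_mul_bar_eq (hpr : p ∣ r) (hgcd : Nat.gcd p n = 1) (g : ReflGroup r p n) :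
    (p : ℚ) * Nat.card {h : ReflGroup r p n // h * ReflGroup.barHom r p n h = g} =
      ∑ t with t * t = (g : WreathProd r n).perm,
        weight (g : WreathProd r n).perm (g : WreathProd r n).z t := by
  let _ : Fintype (ReflGroup r p n) := Fintype.ofFinite _
  set π := (g : WreathProd r n).perm with hπ
  set x := (g : WreathProd r n).z with hx
  let Y (t : Equiv.Perm (Fin n)) : Finset (Fin n → ZMod r) :=
    Finset.univ.filter fun u => ∀ i, u (t i) - u i = x i
  let Y' (t : Equiv.Perm (Fin n)) : Finset (Fin n → ZMod r) :=
    (Y t).filter fun u => ∑ i, u i ∈ AddSubgroup.zmultiples (p : ZMod r)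
  have hiff (h : WreathProd r n) : h * bar h = g ↔ h.perm * h.perm = π ∧ h.z ∈ Y h.perm := by
    simp only [Y, Finset.mem_filter, Finset.mem_univ, true_and]
    constructor
    · intro hh
      refine ⟨by rw [hπ, ← hh]; rfl, fun i => ?_⟩
      rw [hx, ← hh, mul_z, sub_eq_add_neg]
      rfl
    · rintro ⟨h1, h3⟩
      refine WreathProd.ext (funext fun i => ?_) h1
      rw [← hx, ← h3, mul_z, sub_eq_add_neg]
      rfl
  have hcard : Nat.card {h : ReflGroup r p n // h * ReflGroup.barHom r p n h = g} =
      ∑ t with t * t = π, (Y' t).card := by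
    rw [Nat.card_eq_fintype_card, Fintype.card_subtype, ← Finset.card_sigma]
    refine Finset.card_bij (fun h _ => ⟨(h : WreathProd r n).perm, (h : WreathProd r n).z⟩)
      (fun h hh => ?_) (fun h _ h' _ e => ?_) fun a ha => ?_
    · have h1 := (hiff h).1 (congrArg Subtype.val (Finset.mem_filter.1 hh).2)
      rw [Finset.mem_sigma, Finset.mem_filter, Finset.mem_filter]
      exact ⟨⟨Finset.mem_univ _, h1.1⟩, h1.2, ReflGroup.mem_iff.1 h.2⟩
    · simp only [Sigma.mk.injEq, heq_eq_eq] at e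
      refine Subtype.ext (WreathProd.ext e.2 ?_)
      exact e.1
    · rw [Finset.mem_sigma, Finset.mem_filter, Finset.mem_filter] at ha
      refine ⟨⟨⟨a.2, a.1⟩, ReflGroup.mem_iff.2 ha.2.2⟩, ?_, rfl⟩
      rw [Finset.mem_filter]
      exact ⟨Finset.mem_univ _, Subtype.ext ((hiff ⟨a.2, a.1⟩).2 ⟨ha.1.2, ha.2.1⟩)⟩
  rw [hcard, Nat.cast_sum, Finset.mul_sum]
  refine Finset.sum_congr rfl fun t ht => ?_
  have ht' := (Finset.mem_filter.1 ht).2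
  have hY : p * (Y' t).card = (Y t).card :=
    mul_card_filter_sum_mem hpr hgcd (Y t) fun y c hy => by
      refine Finset.mem_filter.2 ⟨Finset.mem_univ _, fun i => ?_⟩
      rw [add_sub_add_right_eq_sub, (Finset.mem_filter.1 hy).2 i]
  rw [← Nat.cast_mul, hY, weight]
  by_cases hb : Balanced π x t
  · obtain ⟨u₀, hu₀⟩ := (balanced_iff_of_sq ht').1 hb
    rw [if_pos hb, ← Fintype.card_subtype, ← Nat.card_eq_fintype_card]
    refine congrArg _ (Nat.card_congr ((Equiv.subRight u₀).subtypeEquiv fun u => ?_))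
    simp only [Equiv.subRight_apply, Pi.sub_apply]
    have h1 (i : Fin n) : u (t i) - u i = x i ↔ u (t i) - u₀ (t i) = u i - u₀ i := by
      rw [← hu₀ i, sub_eq_sub_iff_sub_eq_sub]
    refine ⟨fun h i => ⟨?_, (h1 i).1 (h i)⟩, fun h i => (h1 i).2 (h i).2⟩
    rw [← ht', mul_apply, (h1 _).1 (h _), (h1 _).1 (h _)]
  · rw [if_neg hb, Nat.cast_eq_zero, Finset.card_eq_zero, Finset.filter_eq_empty_iff]
    exact fun u _ hu => hb ((balanced_iff_of_sq ht').2 ⟨u, hu⟩)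

/-- The character of the signed permutation representation counts the solutions of
`h * h̄ = g`. -/
theorem trace_rep_eq_card (hp : 0 < p) (h2pr : 2 * p ∣ r) (hp2 : Even p) (hgcd : Nat.gcd p n = 1)
    (h2 : 2 ∣ r) (g : ReflGroup r p n) :
    LinearMap.trace ℚ _ (rep h2 g) =
      Nat.card {h : ReflGroup r p n // h * ReflGroup.barHom r p n h = g} := by
  classical
  have hp0 : (p : ℚ) ≠ 0 := by exact_mod_cast hp.ne'
  apply mul_left_cancel₀ hp0
  rw [mul_card_mul_bar_eq (dvd_of_mul_left_dvd h2pr) hgcd, ← sum_pairSign_mul_weight_eq_sum_sq,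
    trace_rep, sum_modSign_eq _ g.2, Finset.mul_sum]
  refine Finset.sum_congr rfl fun σ hσ => ?_
  rw [← mul_fixSignSum hp h2pr hp2 hgcd (Finset.mem_filter.1 hσ).2]
  ring

end SymElem

/-- There is a representation of `G(r,p,n)` on `V_{r,p,n}` with
`ρ̃(g) C_ω = modSign(g, ω) C_{g ω gᵀ}`, and it is a Gelfand model. -/
theorem mainTheorem3 (r p n : ℕ) [NeZero r] (hp : 0 < p) (hn : 0 < n) (hpr : p ∣ r)
    (hgcd : Nat.gcd p n = 1) (hp_even : Even p) (hrp_even : Even (r / p)) :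
    ∃ ρ : Representation ℚ (ReflGroup r p n) (SymSpace r p n),
      (∀ (g : ReflGroup r p n) (ω : SymElem r p n),
        ρ g (Finsupp.single ω 1) =
          WreathProd.modSign p (g : WreathProd r n) (ω.1 : WreathProd r n) •
            Finsupp.single (ω.conj g) 1) ∧
      IsGelfandModel ρ.complexify := by
  have h2pr : 2 * p ∣ r := by
    obtain ⟨k, hk⟩ := hrp_even.two_dvd
    exact ⟨k, by rw [← Nat.div_mul_cancel hpr, hk]; ring⟩
  have h2 : 2 ∣ r := dvd_of_mul_right_dvd h2pr
  refine ⟨SymElem.rep h2, SymElem.rep_single h2,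
    Representation.isGelfandModel_of_character _ (ReflGroup.barHom r p n)
      ReflGroup.barHom_barHom (ReflGroup.isConj_barHom hgcd) fun g => ?_⟩
  rw [← Rat.cast_natCast (α := ℂ), ← SymElem.trace_rep_eq_card hp h2pr hp_even hgcd h2]
  exact LinearMap.trace_baseChange (SymElem.rep h2 g) ℂ
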